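/- Let $X_1,X_2,\dots$ be independent random variables with common distribution function $F$ on $\mathbb R$. For $u\in(0,1)$ let $x_u=\inf\{x:F(x)\ge u\}$, and let $\widehat x_u$ be the Hyndman–Fan Type 8 sample quantile of $X_1,\dots,X_n$: with $t=nu+(u+1)/3$, $j=\lfloor t\rfloor$, $\delta=t-j$, $\widehat x_u=(1-\delta)X_{(j)}+\delta X_{(j+1)}$ ($X_{(0)}$ is read as $X_{(1)}$, and $X_{(k)}$ as $X_{(n)}$ for $k>n$). Call $u$ regular if $F$ is differentiable at $x_u$ with derivative $f(x_u)>0$ (e.g. if $F$ has a density $f$ that is continuous and positive at $x_u$), and put $h(u)=1/f(x_u)$. For $p\in(0,\tfrac12)$ let $S_p=x_{1-p}+x_p-2x_{1/2}$, $R_{1,p}=x_{1-p}-x_p$, $R_{2,p}=x_{1/2}-x_p$, $\gamma_p=S_p/R_{1,p}$, $\lambda_p=S_p/R_{2,p}$, and let $s_p,r_{1,p},r_{2,p},g_p,l_p$ be their estimators, obtained by replacing each $x_u$ by $\widehat x_u$ (a quotient with zero denominator is read as $0$). We say that estimators $T_n=(T_{n,i})_{i\in I}$ ($I$ finite) of $\theta$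 have asymptotic covariances $V=(V_{ij})$, written $n\,\mathrm{Cov}(T_{n,i},T_{n,j})\doteq V_{ij}$, if $V$ is positive semidefinite and $\sqrt n\,(T_n-\theta)$ converges in distribution to $N(0,V)$; for one real estimator we write $n\,\mathrm{Var}(T_n)\doteq V$. Let $$\xi_{u,v}=\min(u,v)\,(1-\max(u,v))\,h(u)h(v).$$ 1. For any finitely many regular $u_1,\dots,u_m\in(0,1)$, the sample quantiles $(\widehat x_{u_i})_i$, as estimators of $(x_{u_i})_i$, are jointly asymptotically normal with $n\,\mathrm{Cov}(\widehat x_{u_i},\widehat x_{u_j})\doteq\xi_{u_i,u_j}$. 2. Let $p_1,\dots,p_m\in(0,\tfrac12)$ be such that $\tfrac12$ and all $p_i$, $1-p_i$ are regular. Then the vector of all $s_{p_i}$ and $r_{1,p_i}$, and likewise the vector of all $s_{p_i}$ and $r_{2,p_i}$, is jointly asymptotically normal (centred at the population values), and for $p,q$ among the $p_i$ the asymptotic covariances are $$\begin{aligned} n\mathrm{Cov}(s_p,s_q)&\doteq \xi_{1-p,1-q}+\xi_{1-p,q}+\xi_{p,1-q}+\xi_{p,q}-2\xi_{1-p,1/2}-2\xi_{p,1/2}-2\xi_{1/2,1-q}-2\xi_{1/2,q}+4\xi_{1/2,1/2},\\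 n\mathrm{Cov}(s_p,r_{1,q})&\doteq \xi_{1-p,1-q}-\xi_{1-p,q}+\xi_{p,1-q}-\xi_{p,q}-2\xi_{1/2,1-q}+2\xi_{1/2,q},\\ n\mathrm{Cov}(r_{1,p},s_q)&\doteq \xi_{1-p,1-q}+\xi_{1-p,q}-2\xi_{1-p,1/2}-\xi_{p,1-q}-\xi_{p,q}+2\xi_{p,1/2},\\ n\mathrm{Cov}(r_{1,p},r_{1,q})&\doteq \xi_{1-p,1-q}-\xi_{1-p,q}-\xi_{p,1-q}+\xi_{p,q},\\ n\mathrm{Cov}(s_p,r_{2,q})&\doteq \xi_{1-p,1/2}-\xi_{1-p,q}+\xi_{p,1/2}-\xi_{p,q}+2\xi_{1/2,q}-2\xi_{1/2,1/2},\\ n\mathrm{Cov}(r_{2,p},s_q)&\doteq \xi_{1/2,1-q}+\xi_{1/2,q}-\xi_{p,1-q}-\xi_{p,q}+2\xi_{p,1/2}-2\xi_{1/2,1/2},\\ n\mathrm{Cov}(r_{2,p},r_{2,q})&\doteq \xi_{p,q}-\xi_{1/2,q}-\xi_{p,1/2}+\xi_{1/2,1/2}. \end{aligned}$$ Write $C(\cdot,\cdot)$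 for these right-hand sides. The vectors $(g_{p_i})_i$ and $(l_{p_i})_i$ are each jointly asymptotically normal, centred at $(\gamma_{p_i})_i$ and $(\lambda_{p_i})_i$, with $n\mathrm{Cov}(g_p,g_q)\doteq\sigma_{1,pq}$ and $n\mathrm{Cov}(l_p,l_q)\doteq\sigma_{2,pq}$, where $$\sigma_{1,pq}=\frac{C(s_p,s_q)-\gamma_qC(s_p,r_{1,q})-\gamma_pC(r_{1,p},s_q)+\gamma_p\gamma_qC(r_{1,p},r_{1,q})}{R_{1,p}R_{1,q}},$$ $$\sigma_{2,pq}=\frac{C(s_p,s_q)-\lambda_qC(s_p,r_{2,q})-\lambda_pC(r_{2,p},s_q)+\lambda_p\lambda_qC(r_{2,p},r_{2,q})}{R_{2,p}R_{2,q}}.$$ 3. If $p\in(0,\tfrac12)$ and $p,\tfrac12,1-p$ are regular, then $R_{1,p},R_{2,p}>0$, $g_p$ and $l_p$ are asymptotically normal estimators of $\gamma_p$ and $\lambda_p$ with $n\mathrm{Var}(g_p)\doteq\sigma_{1,pp}$ and $n\mathrm{Var}(l_p)\doteq\sigma_{2,pp}$, and, if $S_p\ne0$, $$\sigma_{1,pp}=\gamma_p^2\Big\{\frac{C(s_p,s_p)}{S_p^2}+\frac{C(r_{1,p},r_{1,p})}{R_{1,p}^2}-\frac{2C(s_p,r_{1,p})}{S_pR_{1,p}}\Big\},\qquad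 \sigma_{2,pp}=\lambda_p^2\Big\{\frac{C(s_p,s_p)}{S_p^2}+\frac{C(r_{2,p},r_{2,p})}{R_{2,p}^2}-\frac{2C(s_p,r_{2,p})}{S_pR_{2,p}}\Big\}.$$ 4. Let $J\ge1$ and $p_j=0.5\,(j-\tfrac12)/J$ for $j=1,\dots,J$, with $\tfrac12$ and all $p_j,1-p_j$ regular. The Riemann-sum AUC estimators $\frac1J\sum_jg_{p_j}$, $\frac1J\sum_jl_{p_j}$, $\frac1J\sum_jp_jg_{p_j}$ and $\frac1J\sum_jp_jl_{p_j}$ are asymptotically normal, centred at $\frac1J\sum_j\gamma_{p_j}$, $\frac1J\sum_j\lambda_{p_j}$, $\frac1J\sum_jp_j\gamma_{p_j}$ and $\frac1J\sum_jp_j\lambda_{p_j}$, with asymptotic variances, respectively, $$\frac1{J^2}\sum_{j,k=1}^J\sigma_{1,p_jp_k},\quad \frac1{J^2}\sum_{j,k=1}^J\sigma_{2,p_jp_k},\quad \frac1{J^2}\sum_{j,k=1}^Jp_jp_k\,\sigma_{1,p_jp_k},\quad \frac1{J^2}\sum_{j,k=1}^Jp_jp_k\,\sigma_{2,p_jp_k}.$$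 -/

import Mathlib

open MeasureTheory ProbabilityTheory Filter Topology

noncomputable section

/-! ### Population and sample quantiles -/

/-- The `u`-th quantile `x_u = inf {x : F(x) ≥ u}` of the distribution `P` on the line, where
`F` is the distribution function of `P`. -/
def quantile (P : Measure ℝ) (u : ℝ) : ℝ :=
  sInf {x : ℝ | u ≤ cdf P x}

/-- `P` is regular at level `u`, with density value `f (x_u)`: the distribution function is
differentiable at the quantile `x_u`, with derivative `f (x_u) > 0`. This is the case when `f` is a
density of `P` that is continuous and positive at `x_u`. -/
def RegularAt (P : Measure ℝ) (f : ℝ → ℝ) (u : ℝ) : Prop :=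
  HasDerivAt (fun x => cdf P x) (f (quantile P u)) (quantile P u) ∧ 0 < f (quantile P u)

/-- The quantile density function `h(u) = 1 / f(x_u)`. -/
def quantileDensity (P : Measure ℝ) (f : ℝ → ℝ) (u : ℝ) : ℝ :=
  1 / f (quantile P u)

/-- The order statistic `X_(k)` (with `1 ≤ k ≤ n`) of the sample `x 0, …, x (n - 1)`. Outside the
range, `X_(0)` is read as `X_(1)`, and `X_(k)` as `X_(n)` for `k > n`; for the empty sample the
value is `0`. -/
def orderStat {n : ℕ} (x : Fin n → ℝ) (k : ℕ) : ℝ :=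
  if h : 0 < n then
    x (Tuple.sort x ⟨min (k - 1) (n - 1), lt_of_le_of_lt (min_le_right _ _) (Nat.sub_lt h one_pos)⟩)
  else 0

/-- The position `n u + (u + 1) / 3` of the Hyndman-Fan Type 8 quantile estimator. -/
def type8Position (n : ℕ) (u : ℝ) : ℝ := n * u + (u + 1) / 3

/-- The Hyndman-Fan Type 8 sample quantile (linear interpolation of two adjacent order
statistics): with `t = n u + (u + 1) / 3`, `j = ⌊t⌋` and `δ = t - j`, it is
`(1 - δ) X_(j) + δ X_(j+1)`. -/
def sampleQuantile {n : ℕ} (x : Fin n → ℝ) (u : ℝ) : ℝ :=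
  (1 - Int.fract (type8Position n u)) * orderStat x ⌊type8Position n u⌋₊
    + Int.fract (type8Position n u) * orderStat x (⌊type8Position n u⌋₊ + 1)

/-! ### Quantile skewness measures

They are functionals of a function `Q : u ↦ Q u`, used both with `Q = quantile P` (population values
`S_p, R_{1,p}, R_{2,p}, γ_p, λ_p`) and with `Q = sampleQuantile x` (estimators
`s_p, r_{1,p}, r_{2,p}, g_p, l_p`). -/

/-- Interquantile skewness `x_{1-p} + x_p - 2 x_{1/2}`. -/
def skewS (Q : ℝ → ℝ) (p : ℝ) : ℝ := Q (1 - p) + Q p - 2 * Q (1 / 2)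

/-- Interquantile range `x_{1-p} - x_p`. -/
def rangeR1 (Q : ℝ → ℝ) (p : ℝ) : ℝ := Q (1 - p) - Q p

/-- Lower half-range `x_{1/2} - x_p`. -/
def rangeR2 (Q : ℝ → ℝ) (p : ℝ) : ℝ := Q (1 / 2) - Q p

/-- The generalized Bowley coefficient `γ_p`. -/
def skewGamma (Q : ℝ → ℝ) (p : ℝ) : ℝ := skewS Q p / rangeR1 Q p

/-- The skewness coefficient `λ_p`. -/
def skewLambda (Q : ℝ → ℝ) (p : ℝ) : ℝ := skewS Q p / rangeR2 Q p

/-- The grid points `p_j = 0.5 (j - 1/2) / J`, `j = 1, …, J`. -/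
def gridPoint (J j : ℕ) : ℝ := (1 / 2) * ((j : ℝ) - 1 / 2) / J

/-- The Riemann-sum estimator `(1/J) ∑_{j=1}^J c(p_j)` of the area under the curve `c`. -/
def aucSum (J : ℕ) (c : ℝ → ℝ) : ℝ :=
  (1 / (J : ℝ)) * ∑ j ∈ Finset.Icc 1 J, c (gridPoint J j)

/-! ### Asymptotic covariances -/

section Covariances

variable (P : Measure ℝ) (f : ℝ → ℝ)

/-- `n Cov(x̂_u, x̂_v)`: it is `u (1 - v) h(u) h(v)` for `u ≤ v` and `v (1 - u) h(u) h(v)` for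
`v ≤ u`. -/
def xi (u v : ℝ) : ℝ :=
  min u v * (1 - max u v) * quantileDensity P f u * quantileDensity P f v

/-- `n Cov(s_p, s_q)`. -/
def covSS (p q : ℝ) : ℝ :=
  xi P f (1 - p) (1 - q) + xi P f (1 - p) q + xi P f p (1 - q) + xi P f p q
    - 2 * xi P f (1 - p) (1 / 2) - 2 * xi P f p (1 / 2)
    - 2 * xi P f (1 / 2) (1 - q) - 2 * xi P f (1 / 2) q + 4 * xi P f (1 / 2) (1 / 2)

/-- `n Cov(s_p, r_{1,q})`. -/
def covSR1 (p q : ℝ) : ℝ :=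
  xi P f (1 - p) (1 - q) - xi P f (1 - p) q + xi P f p (1 - q) - xi P f p q
    - 2 * xi P f (1 / 2) (1 - q) + 2 * xi P f (1 / 2) q

/-- `n Cov(r_{1,p}, s_q)`. -/
def covR1S (p q : ℝ) : ℝ :=
  xi P f (1 - p) (1 - q) + xi P f (1 - p) q - 2 * xi P f (1 - p) (1 / 2)
    - xi P f p (1 - q) - xi P f p q + 2 * xi P f p (1 / 2)

/-- `n Cov(r_{1,p}, r_{1,q})`. -/
def covR1R1 (p q : ℝ) : ℝ :=
  xi P f (1 - p) (1 - q) - xi P f (1 - p) q - xi P f p (1 - q) + xi P f p q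

/-- `n Cov(s_p, r_{2,q})`. -/
def covSR2 (p q : ℝ) : ℝ :=
  xi P f (1 - p) (1 / 2) - xi P f (1 - p) q + xi P f p (1 / 2) - xi P f p q
    + 2 * xi P f (1 / 2) q - 2 * xi P f (1 / 2) (1 / 2)

/-- `n Cov(r_{2,p}, s_q)`. -/
def covR2S (p q : ℝ) : ℝ :=
  xi P f (1 / 2) (1 - q) + xi P f (1 / 2) q - xi P f p (1 - q) - xi P f p q
    + 2 * xi P f p (1 / 2) - 2 * xi P f (1 / 2) (1 / 2)

/-- `n Cov(r_{2,p}, r_{2,q})`. -/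
def covR2R2 (p q : ℝ) : ℝ :=
  xi P f p q - xi P f (1 / 2) q - xi P f p (1 / 2) + xi P f (1 / 2) (1 / 2)

/-- `σ_{1,pq}`, the asymptotic covariance of `g_p` and `g_q`. -/
def sigma1 (p q : ℝ) : ℝ :=
  1 / (rangeR1 (quantile P) p * rangeR1 (quantile P) q) *
    (covSS P f p q - skewGamma (quantile P) q * covSR1 P f p q
      - skewGamma (quantile P) p * covR1S P f p q
      + skewGamma (quantile P) p * skewGamma (quantile P) q * covR1R1 P f p q)

/-- `σ_{2,pq}`, the asymptotic covariance of `l_p` and `l_q`. -/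
def sigma2 (p q : ℝ) : ℝ :=
  1 / (rangeR2 (quantile P) p * rangeR2 (quantile P) q) *
    (covSS P f p q - skewLambda (quantile P) q * covSR2 P f p q
      - skewLambda (quantile P) p * covR2S P f p q
      + skewLambda (quantile P) p * skewLambda (quantile P) q * covR2R2 P f p q)

end Covariances

/-! ### Asymptotic variances and covariances of estimators -/

/-- The vector estimators `T n` of `θ` are jointly asymptotically normal with asymptotic covariance
matrix `V`: the matrix `V` is positive semidefinite and `√n (T n - θ)` converges in distribution
to the normal law `N(0, V)`. -/
def AsympNormalVec {Ω : Type*} [MeasurableSpace Ω] (μ : Measure Ω) [IsProbabilityMeasure μ]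
    {ι : Type*} [Fintype ι] [DecidableEq ι]
    (T : ℕ → Ω → ι → ℝ) (θ : ι → ℝ) (V : Matrix ι ι ℝ) : Prop :=
  V.PosSemidef ∧
    TendstoInDistribution
      (fun (n : ℕ) (ω : Ω) => WithLp.toLp 2 (fun i => √(n : ℝ) * (T n ω i - θ i)))
      atTop (id : EuclideanSpace ℝ ι → EuclideanSpace ℝ ι) (fun _ => μ) (multivariateGaussian 0 V)

/-- The real estimators `T n` of `θ` are asymptotically normal with asymptotic variance `v`:
`v ≥ 0` and `√n (T n - θ)` converges in distribution to the normal law `N(0, v)`. -/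
def AsympNormal {Ω : Type*} [MeasurableSpace Ω] (μ : Measure Ω) [IsProbabilityMeasure μ]
    (T : ℕ → Ω → ℝ) (θ v : ℝ) : Prop :=
  0 ≤ v ∧
    TendstoInDistribution (fun (n : ℕ) (ω : Ω) => √(n : ℝ) * (T n ω - θ))
      atTop (id : ℝ → ℝ) (fun _ => μ) (gaussianReal 0 v.toNNReal)

/-- The sample quantile function `u ↦ x̂_u` of the first `n` observations. -/
def empQuantile {Ω : Type*} (X : ℕ → Ω → ℝ) (n : ℕ) (ω : Ω) : ℝ → ℝ :=
  sampleQuantile (fun i : Fin n => X i ω)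

end

/-!
Every estimator in the theorem is asymptotically linear (`AsympLinear`): up to an error that tends to
`0` in probability, `√n (T n - θ)` is the normalized sum `n^{-1/2} ∑ ψ (X_k)` of a centred, square
integrable influence function `ψ` of the observations. Such estimators are jointly asymptotically
normal with asymptotic covariances `∫ ψ_i ψ_j dP` (`AsympLinear.asympNormalVec`), by the
one-dimensional central limit theorem applied to all linear combinations and by Slutsky's theorem.
Positive semidefiniteness comes for free, since the asymptotic covariance matrix is a Gram matrix.

Asymptotic linearity passes to linear combinations and, by the delta method, to quotients with
nonzero limiting denominator (`AsympLinear.div`). What remains is the sample quantile itself, whose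
influence function is `h(u) (F(x_u) - 1{x ≤ x_u})` (`RegularAt.asympLinear_empQuantile`, the Bahadur
representation in Ghosh's weak form). The Type 8 quantile lies between two adjacent order
statistics of rank `n u + O(1)`, so the event that it is at most `x_u + y / √n` is, up to a
negligible shift of the rank, the event that the empirical distribution function at that point
exceeds `u`. The empirical process at `x_u + y / √n` and at `x_u` differ by a term of vanishing
variance, and differentiability of `F` at `x_u` turns the deterministic part into `y`. Thus the
centred quantile and the linear term fall on different sides of any level `y` by a fixed margin only
with vanishing probability, which forces their difference to `0`
(`tendstoInMeasure_sub_of_separation`).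

The asymptotic covariances are then integrals of products of influence functions. All reduce to
`∫ ψ_u ψ_v dP = ξ_{u,v}` (`integral_quantileInfluence_mul`) by bilinearity.
-/

noncomputable section

/-! ### Convergence and boundedness in probability -/

section InProbability

variable {Ω : Type*} [MeasurableSpace Ω] {μ : Measure Ω}

lemma tendstoInMeasure_zero_iff {f : ℕ → Ω → ℝ} :
    TendstoInMeasure μ f atTop 0 ↔
      ∀ ε, 0 < ε → Tendsto (fun n => μ {ω | ε ≤ |f n ω|}) atTop (𝓝 0) := by
  simp [tendstoInMeasure_iff_norm]

lemma tendstoInMeasure_zero_add {f g : ℕ → Ω → ℝ} (hf : TendstoInMeasure μ f atTop 0)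
    (hg : TendstoInMeasure μ g atTop 0) :
    TendstoInMeasure μ (fun n ω => f n ω + g n ω) atTop 0 := by
  rw [tendstoInMeasure_zero_iff] at *
  intro ε hε
  have h := (hf (ε / 2) (half_pos hε)).add (hg (ε / 2) (half_pos hε))
  rw [add_zero] at h
  refine tendsto_of_tendsto_of_tendsto_of_le_of_le tendsto_const_nhds h (fun _ => zero_le) ?_
  intro n
  refine (measure_mono ?_).trans (measure_union_le _ _)
  intro ω hω
  simp only [Set.mem_ofPred_eq, Set.mem_union] at hω ⊢
  by_contra! hcon
  linarith [abs_add_le (f n ω) (g n ω)]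

lemma tendstoInMeasure_zero_const_mul {f : ℕ → Ω → ℝ} (c : ℝ)
    (hf : TendstoInMeasure μ f atTop 0) :
    TendstoInMeasure μ (fun n ω => c * f n ω) atTop 0 := by
  rw [tendstoInMeasure_zero_iff] at *
  intro ε hε
  have hc : 0 < |c| + 1 := by positivity
  refine tendsto_of_tendsto_of_tendsto_of_le_of_le tendsto_const_nhds
    (hf (ε / (|c| + 1)) (by positivity)) (fun _ => zero_le) ?_
  refine fun n => measure_mono fun ω hω => ?_
  simp only [Set.mem_ofPred_eq, abs_mul] at hω ⊢
  rw [div_le_iff₀ hc]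
  nlinarith [abs_nonneg (f n ω)]

/-- Sequences that agree outside events of vanishing probability have the same limits in
probability. -/
lemma tendstoInMeasure_zero_of_eq_off {f g : ℕ → Ω → ℝ} {s : ℕ → Set Ω}
    (hf : TendstoInMeasure μ f atTop 0) (hs : Tendsto (fun n => μ (s n)) atTop (𝓝 0))
    (hfg : ∀ n, ∀ ω ∉ s n, g n ω = f n ω) : TendstoInMeasure μ g atTop 0 := by
  rw [tendstoInMeasure_zero_iff] at *
  intro ε hε
  have h := (hf ε hε).add hs
  rw [add_zero] at h
  refine tendsto_of_tendsto_of_tendsto_of_le_of_le tendsto_const_nhds h (fun _ => zero_le) ?_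
  intro n
  refine (measure_mono ?_).trans (measure_union_le _ _)
  intro ω hω
  by_cases h : ω ∈ s n
  · exact Or.inr h
  · exact Or.inl (by simpa [hfg n ω h] using hω)

/-- The sequence `W` is asymptotically bounded in probability (`W n = O_P(1)`). -/
def BddInProb (μ : Measure Ω) (W : ℕ → Ω → ℝ) : Prop :=
  ∀ η : ENNReal, 0 < η → ∃ M : ℝ, 0 < M ∧ ∀ᶠ n in atTop, μ {ω | M ≤ |W n ω|} ≤ η

lemma BddInProb.add_tendstoInMeasure_zero {W f : ℕ → Ω → ℝ} (hW : BddInProb μ W)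
    (hf : TendstoInMeasure μ f atTop 0) : BddInProb μ (fun n ω => f n ω + W n ω) := by
  rw [tendstoInMeasure_zero_iff] at hf
  intro η hη
  obtain ⟨M, hM, hWM⟩ := hW (η / 2) (ENNReal.half_pos hη.ne')
  refine ⟨M + 1, by positivity, ?_⟩
  filter_upwards [hWM, ENNReal.tendsto_nhds_zero.1 (hf 1 one_pos) (η / 2) (ENNReal.half_pos hη.ne')]
    with n h1 h2
  rw [← ENNReal.add_halves η]
  refine le_trans ((measure_mono ?_).trans (measure_union_le _ _)) (add_le_add h1 h2)
  intro ω hω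
  simp only [Set.mem_ofPred_eq, Set.mem_union] at hω ⊢
  by_contra! hcon
  linarith [abs_add_le (f n ω) (W n ω)]

lemma BddInProb.mul_tendstoInMeasure_zero {W f : ℕ → Ω → ℝ} (hW : BddInProb μ W)
    (hf : TendstoInMeasure μ f atTop 0) :
    TendstoInMeasure μ (fun n ω => W n ω * f n ω) atTop 0 := by
  rw [tendstoInMeasure_zero_iff] at *
  intro ε hε
  refine ENNReal.tendsto_nhds_zero.2 fun η hη => ?_
  obtain ⟨M, hM, hWM⟩ := hW (η / 2) (ENNReal.half_pos hη.ne')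
  filter_upwards [hWM, ENNReal.tendsto_nhds_zero.1 (hf (ε / M) (by positivity)) (η / 2)
    (ENNReal.half_pos hη.ne')] with n h1 h2
  rw [← ENNReal.add_halves η]
  refine le_trans ((measure_mono ?_).trans (measure_union_le _ _)) (add_le_add h1 h2)
  intro ω hω
  simp only [Set.mem_ofPred_eq, Set.mem_union, abs_mul] at hω ⊢
  by_contra! hcon
  obtain ⟨h3, h4⟩ := hcon
  rw [lt_div_iff₀ hM] at h4
  nlinarith [abs_nonneg (f n ω), abs_nonneg (W n ω)]

lemma tendstoInMeasure_zero_of_bddInProb_sqrt_mul {f : ℕ → Ω → ℝ}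
    (h : BddInProb μ (fun n ω => √(n : ℝ) * f n ω)) : TendstoInMeasure μ f atTop 0 := by
  rw [tendstoInMeasure_zero_iff]
  intro ε hε
  refine ENNReal.tendsto_nhds_zero.2 fun η hη => ?_
  obtain ⟨M, hM, hWM⟩ := h η hη
  have hlim : Tendsto (fun n : ℕ => √(n : ℝ)) atTop atTop :=
    Real.tendsto_sqrt_atTop.comp tendsto_natCast_atTop_atTop
  filter_upwards [hWM, hlim.eventually_ge_atTop (M / ε)] with n h1 h2
  refine (measure_mono fun ω hω => ?_).trans h1
  simp only [Set.mem_ofPred_eq, abs_mul, abs_of_nonneg (Real.sqrt_nonneg _)] at hω ⊢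
  calc M = M / ε * ε := by field_simp
    _ ≤ √(n : ℝ) * |f n ω| := by gcongr

lemma tendstoInMeasure_inv_sub_inv {r : ℕ → Ω → ℝ} {R : ℝ} (hR : R ≠ 0)
    (h : TendstoInMeasure μ (fun n ω => r n ω - R) atTop 0) :
    TendstoInMeasure μ (fun n ω => (r n ω)⁻¹ - R⁻¹) atTop 0 := by
  rw [tendstoInMeasure_zero_iff] at *
  intro ε hε
  have hR' : 0 < |R| := abs_pos.2 hR
  refine tendsto_of_tendsto_of_tendsto_of_le_of_le tendsto_const_nhds
    (h (min (|R| / 2) (ε * |R| ^ 2 / 2)) (by positivity)) (fun _ => zero_le) ?_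
  refine fun n => measure_mono fun ω hω => ?_
  simp only [Set.mem_ofPred_eq] at hω ⊢
  by_contra! hcon
  obtain ⟨h1, h2⟩ := lt_min_iff.1 hcon
  have h3 : |R| / 2 < |r n ω| := by
    have := abs_sub_abs_le_abs_sub R (r n ω)
    rw [abs_sub_comm] at this
    linarith
  have h4 : r n ω ≠ 0 := abs_pos.1 (by linarith)
  rw [inv_sub_inv h4 hR, abs_div, abs_mul, abs_sub_comm, le_div_iff₀ (by positivity)] at hω
  have : |R| / 2 * |R| ≤ |r n ω| * |R| := by gcongr
  nlinarith

end InProbability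

/-! ### Normalized sums of a function of the observations -/

section NormSum

variable {Ω : Type*}

/-- The normalized sum `n^{-1/2} ∑_{k < n} ψ (X_k)`, which is `0` for `n = 0`. -/
def normSum (X : ℕ → Ω → ℝ) (ψ : ℝ → ℝ) (n : ℕ) (ω : Ω) : ℝ :=
  (√(n : ℝ))⁻¹ * ∑ k ∈ Finset.range n, ψ (X k ω)

lemma normSum_add (X : ℕ → Ω → ℝ) (φ ψ : ℝ → ℝ) (n : ℕ) (ω : Ω) :
    normSum X (fun x => φ x + ψ x) n ω = normSum X φ n ω + normSum X ψ n ω := by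
  simp only [normSum, Finset.sum_add_distrib]; ring

lemma normSum_sub (X : ℕ → Ω → ℝ) (φ ψ : ℝ → ℝ) (n : ℕ) (ω : Ω) :
    normSum X (fun x => φ x - ψ x) n ω = normSum X φ n ω - normSum X ψ n ω := by
  simp only [normSum, Finset.sum_sub_distrib]; ring

lemma normSum_const_mul (X : ℕ → Ω → ℝ) (c : ℝ) (ψ : ℝ → ℝ) (n : ℕ) (ω : Ω) :
    normSum X (fun x => c * ψ x) n ω = c * normSum X ψ n ω := by
  simp only [normSum, ← Finset.mul_sum]; ring

lemma normSum_sum {ι : Type*} (s : Finset ι) (X : ℕ → Ω → ℝ) (ψ : ι → ℝ → ℝ) (n : ℕ) (ω : Ω) :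
    normSum X (fun x => ∑ i ∈ s, ψ i x) n ω = ∑ i ∈ s, normSum X (ψ i) n ω := by
  simp only [normSum, ← Finset.mul_sum]
  rw [Finset.sum_comm]

variable [MeasurableSpace Ω] {μ : Measure Ω} {P : Measure ℝ} {X : ℕ → Ω → ℝ} {ψ : ℝ → ℝ}

lemma ProbabilityTheory.HasLaw.memLp_comp {Y : Ω → ℝ} (hY : HasLaw Y P μ) (hψ2 : MemLp ψ 2 P) :
    MemLp (fun ω => ψ (Y ω)) 2 μ := by
  rw [← hY.map_eq] at hψ2
  exact (memLp_map_measure_iff hψ2.1 hY.aemeasurable).1 hψ2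

lemma ProbabilityTheory.HasLaw.variance_comp {Y : Ω → ℝ} (hY : HasLaw Y P μ) (hψ : Measurable ψ) :
    Var[fun ω => ψ (Y ω); μ] = Var[ψ; P] := by
  rw [← hY.map_eq, variance_map hψ.aemeasurable hY.aemeasurable]; rfl

lemma ProbabilityTheory.HasLaw.integral_fun_comp {Y : Ω → ℝ} (hY : HasLaw Y P μ) (hψ : Measurable ψ) :
    ∫ ω, ψ (Y ω) ∂μ = ∫ x, ψ x ∂P :=
  hY.integral_comp hψ.aestronglyMeasurable

lemma variance_eq_integral_sq_of_integral_eq_zero (hψ : Measurable ψ) (h0 : ∫ x, ψ x ∂P = 0) :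
    Var[ψ; P] = ∫ x, ψ x * ψ x ∂P := by
  rw [variance_eq_integral hψ.aemeasurable, h0]
  simp [pow_two]

lemma aemeasurable_normSum (hlaw : ∀ i, HasLaw (X i) P μ) (hψ : Measurable ψ) (n : ℕ) :
    AEMeasurable (normSum X ψ n) μ :=
  .const_mul (Finset.aemeasurable_fun_sum _ fun k _ =>
    hψ.comp_aemeasurable (hlaw k).aemeasurable) _

lemma memLp_normSum (hlaw : ∀ i, HasLaw (X i) P μ) (hψ2 : MemLp ψ 2 P) (n : ℕ) :
    MemLp (normSum X ψ n) 2 μ :=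
  MemLp.const_mul (f := fun ω => ∑ k ∈ Finset.range n, ψ (X k ω))
    (memLp_finsetSum _ fun k _ => (hlaw k).memLp_comp hψ2) _

lemma variance_normSum_le (hlaw : ∀ i, HasLaw (X i) P μ) (hindep : iIndepFun X μ)
    (hψ : Measurable ψ) (hψ2 : MemLp ψ 2 P) (n : ℕ) :
    Var[normSum X ψ n; μ] ≤ Var[ψ; P] := by
  have h1 : Var[∑ k ∈ Finset.range n, (fun ω => ψ (X k ω)); μ] = n * Var[ψ; P] := by
    rw [IndepFun.variance_sum (fun k _ => (hlaw k).memLp_comp hψ2)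
      (fun i _ j _ hij => (hindep.indepFun hij).comp hψ hψ)]
    simp [(hlaw _).variance_comp hψ]
  have h2 : normSum X ψ n =
      fun ω => (√(n : ℝ))⁻¹ * (∑ k ∈ Finset.range n, (fun ω => ψ (X k ω))) ω := by
    ext ω; simp [normSum]
  rw [h2, variance_const_mul, h1, inv_pow, Real.sq_sqrt (Nat.cast_nonneg n)]
  rcases Nat.eq_zero_or_pos n with rfl | hn
  · simp [variance_nonneg ψ P]
  · have : (n : ℝ) ≠ 0 := by positivity
    rw [inv_mul_cancel_left₀ this]

variable [IsProbabilityMeasure μ]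

lemma integral_normSum (hlaw : ∀ i, HasLaw (X i) P μ) (hψ : Measurable ψ) (hψ2 : MemLp ψ 2 P)
    (h0 : ∫ x, ψ x ∂P = 0) (n : ℕ) : ∫ ω, normSum X ψ n ω ∂μ = 0 := by
  simp only [normSum]
  rw [integral_const_mul, integral_finsetSum _ fun k _ =>
    ((hlaw k).memLp_comp hψ2).integrable (by norm_num)]
  simp [(hlaw _).integral_fun_comp hψ, h0]

/-- Chebyshev's inequality for a normalized sum, with a bound that does not depend on `n`. -/
lemma measure_normSum_ge_le (hlaw : ∀ i, HasLaw (X i) P μ) (hindep : iIndepFun X μ)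
    (hψ : Measurable ψ) (hψ2 : MemLp ψ 2 P) (h0 : ∫ x, ψ x ∂P = 0) (n : ℕ) {c : ℝ} (hc : 0 < c) :
    μ {ω | c ≤ |normSum X ψ n ω|} ≤ ENNReal.ofReal ((∫ x, ψ x * ψ x ∂P) / c ^ 2) := by
  have h := meas_ge_le_variance_div_sq (memLp_normSum (μ := μ) hlaw hψ2 n) hc
  rw [integral_normSum hlaw hψ hψ2 h0] at h
  simp only [sub_zero] at h
  refine h.trans (ENNReal.ofReal_le_ofReal ?_)
  rw [← variance_eq_integral_sq_of_integral_eq_zero hψ h0]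
  gcongr
  exact variance_normSum_le hlaw hindep hψ hψ2 n

lemma bddInProb_normSum (hlaw : ∀ i, HasLaw (X i) P μ) (hindep : iIndepFun X μ)
    (hψ : Measurable ψ) (hψ2 : MemLp ψ 2 P) (h0 : ∫ x, ψ x ∂P = 0) :
    BddInProb μ (normSum X ψ) := by
  intro η hη
  have hlim : Tendsto (fun M : ℝ => ENNReal.ofReal ((∫ x, ψ x * ψ x ∂P) / M ^ 2)) atTop (𝓝 0) := by
    rw [← ENNReal.ofReal_zero]
    exact ENNReal.tendsto_ofReal
      (tendsto_const_nhds.div_atTop (tendsto_pow_atTop (by norm_num)))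
  obtain ⟨M, hM, hM0⟩ :=
    ((ENNReal.tendsto_nhds_zero.1 hlim η hη).and (eventually_gt_atTop 0)).exists
  exact ⟨M, hM0, .of_forall fun n =>
    (measure_normSum_ge_le hlaw hindep hψ hψ2 h0 n hM0).trans hM⟩

/-- The central limit theorem for normalized sums of a centred function. -/
lemma tendstoInDistribution_normSum (hlaw : ∀ i, HasLaw (X i) P μ) (hindep : iIndepFun X μ)
    (hψ : Measurable ψ) (hψ2 : MemLp ψ 2 P) (h0 : ∫ x, ψ x ∂P = 0) :
    TendstoInDistribution (normSum X ψ) atTop (id : ℝ → ℝ) (fun _ => μ)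
      (gaussianReal 0 (∫ x, ψ x * ψ x ∂P).toNNReal) := by
  have h := tendstoInDistribution_inv_sqrt_mul_sum_sub (P := μ) (X := fun k ω => ψ (X k ω))
    (Y := (id : ℝ → ℝ)) (P' := gaussianReal 0 (∫ x, ψ x * ψ x ∂P).toNNReal)
    (by
      rw [(hlaw 0).variance_comp hψ, variance_eq_integral_sq_of_integral_eq_zero hψ h0]
      exact HasLaw.id)
    ((hlaw 0).memLp_comp hψ2) (hindep.comp (fun _ => ψ) fun _ => hψ)
    (fun i => (IdentDistrib.mk (hlaw i).aemeasurable (hlaw 0).aemeasurable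
      ((hlaw i).map_eq.trans (hlaw 0).map_eq.symm)).comp hψ)
  simpa only [(hlaw 0).integral_fun_comp hψ, h0, mul_zero, sub_zero] using! h

end NormSum

/-! ### Asymptotically linear estimators -/

section AsympLinear

variable {Ω : Type*} [MeasurableSpace Ω]

/-- The real estimators `T n` of `θ`, based on observations `X` with law `P`, are asymptotically
linear with influence function `ψ`: the function `ψ` is centred and square integrable, and
`√n (T n - θ) = n^{-1/2} ∑_{k < n} ψ (X_k) + o_P(1)`. -/
structure AsympLinear (μ : Measure Ω) (P : Measure ℝ) (X : ℕ → Ω → ℝ) (T : ℕ → Ω → ℝ) (θ : ℝ)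
    (ψ : ℝ → ℝ) : Prop where
  aemeasurable : ∀ n, AEMeasurable (T n) μ
  measurable : Measurable ψ
  memLp : MemLp ψ 2 P
  integral_eq_zero : ∫ x, ψ x ∂P = 0
  tendsto : TendstoInMeasure μ (fun (n : ℕ) ω => √(n : ℝ) * (T n ω - θ) - normSum X ψ n ω)
    atTop 0

variable {μ : Measure Ω} {P : Measure ℝ} {X : ℕ → Ω → ℝ} {T T' : ℕ → Ω → ℝ} {θ θ' : ℝ}
  {ψ ψ' : ℝ → ℝ}

namespace AsympLinear

lemma const_mul (c : ℝ) (h : AsympLinear μ P X T θ ψ) :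
    AsympLinear μ P X (fun n ω => c * T n ω) (c * θ) (fun x => c * ψ x) where
  aemeasurable n := (h.aemeasurable n).const_mul c
  measurable := h.measurable.const_mul c
  memLp := h.memLp.const_mul c
  integral_eq_zero := by rw [integral_const_mul, h.integral_eq_zero, mul_zero]
  tendsto := by
    refine (tendstoInMeasure_zero_const_mul c h.tendsto).congr_left fun n => .of_forall fun ω => ?_
    simp only [normSum_const_mul]
    ring

lemma add [IsProbabilityMeasure P] (h : AsympLinear μ P X T θ ψ) (h' : AsympLinear μ P X T' θ' ψ') :
    AsympLinear μ P X (fun n ω => T n ω + T' n ω) (θ + θ') (fun x => ψ x + ψ' x) where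
  aemeasurable n := (h.aemeasurable n).add (h'.aemeasurable n)
  measurable := h.measurable.add h'.measurable
  memLp := h.memLp.add h'.memLp
  integral_eq_zero := by
    rw [integral_add (h.memLp.integrable (by norm_num)) (h'.memLp.integrable (by norm_num)),
      h.integral_eq_zero, h'.integral_eq_zero, add_zero]
  tendsto := by
    refine (tendstoInMeasure_zero_add h.tendsto h'.tendsto).congr_left
      fun n => .of_forall fun ω => ?_
    simp only [normSum_add]
    ring

lemma sub [IsProbabilityMeasure P] (h : AsympLinear μ P X T θ ψ) (h' : AsympLinear μ P X T' θ' ψ') :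
    AsympLinear μ P X (fun n ω => T n ω - T' n ω) (θ - θ') (fun x => ψ x - ψ' x) := by
  simpa only [neg_one_mul, ← sub_eq_add_neg] using h.add (h'.const_mul (-1))

lemma sum [IsProbabilityMeasure P] {ι : Type*} (s : Finset ι) {T : ι → ℕ → Ω → ℝ} {θ : ι → ℝ} {ψ : ι → ℝ → ℝ}
    (h : ∀ i ∈ s, AsympLinear μ P X (T i) (θ i) (ψ i)) :
    AsympLinear μ P X (fun n ω => ∑ i ∈ s, T i n ω) (∑ i ∈ s, θ i) (fun x => ∑ i ∈ s, ψ i x) := by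
  classical
  induction s using Finset.induction_on with
  | empty =>
    refine ⟨fun _ => by simp, by simp, by simp, by simp, ?_⟩
    rw [tendstoInMeasure_zero_iff]
    intro ε hε
    simp [normSum, hε.not_ge]
  | insert a s ha ih =>
    simp only [Finset.sum_insert ha]
    exact (h a (Finset.mem_insert_self a s)).add
      (ih fun i hi => h i (Finset.mem_insert_of_mem hi))

lemma bddInProb [IsProbabilityMeasure μ] (hlaw : ∀ i, HasLaw (X i) P μ) (hindep : iIndepFun X μ)
    (h : AsympLinear μ P X T θ ψ) : BddInProb μ (fun n ω => √(n : ℝ) * (T n ω - θ)) := by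
  simpa using (bddInProb_normSum hlaw hindep h.measurable h.memLp
    h.integral_eq_zero).add_tendstoInMeasure_zero h.tendsto

/-- Asymptotically linear estimators are consistent. -/
lemma consistent [IsProbabilityMeasure μ] (hlaw : ∀ i, HasLaw (X i) P μ) (hindep : iIndepFun X μ)
    (h : AsympLinear μ P X T θ ψ) : TendstoInMeasure μ (fun n ω => T n ω - θ) atTop 0 :=
  tendstoInMeasure_zero_of_bddInProb_sqrt_mul (h.bddInProb hlaw hindep)

/-- The delta method for a quotient. -/
lemma div [IsProbabilityMeasure μ] [IsProbabilityMeasure P]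
    (hlaw : ∀ i, HasLaw (X i) P μ) (hindep : iIndepFun X μ)
    (h : AsympLinear μ P X T θ ψ) (h' : AsympLinear μ P X T' θ' ψ') (hθ' : θ' ≠ 0) :
    AsympLinear μ P X (fun n ω => T n ω / T' n ω) (θ / θ')
      (fun x => θ'⁻¹ * (ψ x - θ / θ' * ψ' x)) := by
  -- The numerator `T - (θ / θ') T'` of `T / T' - θ / θ'` is itself asymptotically linear, with
  -- limit `0`.
  have hD := h.sub (h'.const_mul (θ / θ'))
  have hD' := hD.const_mul θ'⁻¹
  have hcons := h'.consistent hlaw hindep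
  refine ⟨fun n => (h.aemeasurable n).div (h'.aemeasurable n), hD'.measurable, hD'.memLp,
    hD'.integral_eq_zero, ?_⟩
  have hprod := (hD.bddInProb hlaw hindep).mul_tendstoInMeasure_zero
    (tendstoInMeasure_inv_sub_inv hθ' hcons)
  -- Where the denominator vanishes the quotient has its junk value; this has vanishing probability.
  refine tendstoInMeasure_zero_of_eq_off (tendstoInMeasure_zero_add hD'.tendsto hprod)
    (tendstoInMeasure_zero_iff.1 hcons |θ'| (abs_pos.2 hθ')) fun n ω hω => ?_
  have hr : T' n ω ≠ 0 := by
    intro h0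
    simp [h0] at hω
  have key : T n ω / T' n ω - θ / θ' =
      (T n ω - θ / θ' * T' n ω - (θ - θ / θ' * θ')) * (T' n ω)⁻¹ := by
    field_simp
    ring
  simp only [key]
  field_simp
  ring

lemma asympNormal [IsProbabilityMeasure μ] (hlaw : ∀ i, HasLaw (X i) P μ) (hindep : iIndepFun X μ)
    (h : AsympLinear μ P X T θ ψ) {v : ℝ} (hv : ∫ x, ψ x * ψ x ∂P = v) :
    AsympNormal μ T θ v := by
  subst hv
  refine ⟨integral_nonneg fun x => mul_self_nonneg _, ?_⟩
  exact tendstoInDistribution_of_tendstoInMeasure_sub _ _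
    (tendstoInDistribution_normSum hlaw hindep h.measurable h.memLp h.integral_eq_zero) h.tendsto
    fun n => ((h.aemeasurable n).sub_const θ).const_mul _

end AsympLinear

lemma integral_sum_mul_sum {ι κ : Type*} (s : Finset ι) (t : Finset κ) {φ : ι → ℝ → ℝ}
    {χ : κ → ℝ → ℝ} (hφ : ∀ i ∈ s, MemLp (φ i) 2 P) (hχ : ∀ j ∈ t, MemLp (χ j) 2 P)
    (c : ι → ℝ) (d : κ → ℝ) :
    ∫ x, (∑ i ∈ s, c i * φ i x) * (∑ j ∈ t, d j * χ j x) ∂P =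
      ∑ i ∈ s, ∑ j ∈ t, c i * d j * ∫ x, φ i x * χ j x ∂P := by
  have hint : ∀ i ∈ s, ∀ j ∈ t, Integrable (fun x => c i * d j * (φ i x * χ j x)) P :=
    fun i hi j hj => ((hφ i hi).integrable_mul (hχ j hj)).const_mul _
  simp_rw [Finset.sum_mul_sum, mul_mul_mul_comm (c _) _ (d _) _]
  rw [integral_finsetSum _ fun i hi => integrable_finsetSum _ fun j hj => hint i hi j hj]
  refine Finset.sum_congr rfl fun i hi => ?_
  rw [integral_finsetSum _ fun j hj => hint i hi j hj]
  simp_rw [integral_const_mul]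

lemma tendstoInMeasure_toLp {ι : Type*} [Fintype ι] {f : ℕ → Ω → ι → ℝ}
    (hf : ∀ i, TendstoInMeasure μ (fun n ω => f n ω i) atTop 0) :
    TendstoInMeasure μ (fun n ω => (WithLp.toLp 2 (f n ω) : EuclideanSpace ℝ ι)) atTop 0 := by
  rw [tendstoInMeasure_iff_norm]
  intro ε hε
  -- A vector whose coordinates are all less than `ε / (d + 1)` has norm less than `ε`.
  have hd : (0 : ℝ) < Fintype.card ι + 1 := by positivity
  have h : Tendsto (fun n => ∑ i, μ {ω | ε / (Fintype.card ι + 1) ≤ |f n ω i|}) atTop (𝓝 0) := by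
    have := tendsto_finsetSum Finset.univ fun i _ =>
      tendstoInMeasure_zero_iff.1 (hf i) (ε / (Fintype.card ι + 1)) (by positivity)
    simpa using this
  refine tendsto_of_tendsto_of_tendsto_of_le_of_le tendsto_const_nhds h (fun _ => zero_le) ?_
  intro n
  refine (measure_mono fun ω hω => ?_).trans (measure_iUnion_fintype_le _ _)
  simp only [Pi.zero_apply, sub_zero, Set.mem_ofPred_eq, Set.mem_iUnion] at hω ⊢
  by_contra! hcon
  refine hω.not_gt ?_
  have h1 : ‖(WithLp.toLp 2 (f n ω) : EuclideanSpace ℝ ι)‖ ≤ ∑ i, |f n ω i| := by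
    rw [EuclideanSpace.norm_eq]
    refine Real.sqrt_le_iff.2 ⟨Finset.sum_nonneg fun i _ => abs_nonneg _, ?_⟩
    simpa using Finset.sum_sq_le_sq_sum_of_nonneg (s := Finset.univ)
      (f := fun i => |f n ω i|) fun i _ => abs_nonneg _
  have h2 : ∑ i, |f n ω i| ≤ Fintype.card ι * (ε / (Fintype.card ι + 1)) := by
    simpa using Finset.sum_le_card_nsmul Finset.univ (fun i => |f n ω i|) _ fun i _ => (hcon i).le
  refine (h1.trans h2).trans_lt ?_
  rw [← mul_div_assoc, div_lt_iff₀ hd]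
  nlinarith

variable {ι : Type*} [Fintype ι]

/-- The quadratic form of the Gram matrix of the `ψ i` is the integral of a square. This gives its
positive semidefiniteness, and identifies it with the variance in the central limit theorem for the
linear combination `∑ i, t i * ψ i`. -/
lemma quadraticForm_eq_integral_sq {ψ : ι → ℝ → ℝ} (hψ : ∀ i, MemLp (ψ i) 2 P) (t : ι → ℝ) :
    t ⬝ᵥ ((Matrix.of fun i j => ∫ x, ψ i x * ψ j x ∂P).mulVec t) =
      ∫ x, (∑ i, t i * ψ i x) * (∑ i, t i * ψ i x) ∂P := by
  rw [integral_sum_mul_sum _ _ (fun i _ => hψ i) (fun i _ => hψ i)]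
  simp only [dotProduct, Matrix.mulVec, Matrix.of_apply, Finset.mul_sum]
  exact Finset.sum_congr rfl fun i _ => Finset.sum_congr rfl fun j _ => by ring

/-- Joint asymptotic normality of asymptotically linear estimators: the Cramér–Wold device reduces
it to the one-dimensional central limit theorem. -/
theorem AsympLinear.asympNormalVec [DecidableEq ι] [IsProbabilityMeasure P]
    [IsProbabilityMeasure μ] (hlaw : ∀ i, HasLaw (X i) P μ) (hindep : iIndepFun X μ)
    {T : ι → ℕ → Ω → ℝ} {θ : ι → ℝ} {ψ : ι → ℝ → ℝ} {V : Matrix ι ι ℝ}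
    (h : ∀ i, AsympLinear μ P X (T i) (θ i) (ψ i))
    (hV : ∀ i j, ∫ x, ψ i x * ψ j x ∂P = V i j) :
    AsympNormalVec μ (fun n ω i => T i n ω) θ V := by
  obtain rfl : V = Matrix.of fun i j => ∫ x, ψ i x * ψ j x ∂P := by ext i j; simp [hV]
  have hpsd : (Matrix.of fun i j => ∫ x, ψ i x * ψ j x ∂P : Matrix ι ι ℝ).PosSemidef := by
    refine .of_dotProduct_mulVec_nonneg ?_ fun t => ?_
    · ext i j
      simp [mul_comm]
    · rw [star_trivial, quadraticForm_eq_integral_sq fun i => (h i).memLp]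
      exact integral_nonneg fun x => mul_self_nonneg _
  refine ⟨hpsd, ?_⟩
  have hmeas : ∀ n, AEMeasurable
      (fun ω => (WithLp.toLp 2 (fun i => normSum X (ψ i) n ω) : EuclideanSpace ℝ ι)) μ :=
    fun n => (WithLp.measurable_toLp 2 (ι → ℝ)).comp_aemeasurable
      (aemeasurable_pi_lambda _ fun i => aemeasurable_normSum hlaw (h i).measurable n)
  refine tendstoInDistribution_of_tendstoInMeasure_sub
    (X := fun n ω => (WithLp.toLp 2 (fun i => normSum X (ψ i) n ω) : EuclideanSpace ℝ ι))
    _ _ ⟨hmeas, by fun_prop, ?_⟩ ?_ ?_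
  · refine ProbabilityMeasure.tendsto_iff_tendsto_charFun.2 fun t => ?_
    have hlin := AsympLinear.sum Finset.univ fun i _ => (h i).const_mul (t i)
    have h1 := ProbabilityMeasure.tendsto_iff_tendsto_charFun.1
      (tendstoInDistribution_normSum hlaw hindep hlin.measurable hlin.memLp
        hlin.integral_eq_zero).tendsto 1
    simp only [ProbabilityMeasure.coe_mk, Measure.map_id] at h1 ⊢
    rw [charFun_multivariateGaussian hpsd, quadraticForm_eq_integral_sq fun i => (h i).memLp]
    convert h1 using 2 with n
    · rw [charFun_apply, charFun_apply, integral_map (hmeas n) (by fun_prop),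
        integral_map (aemeasurable_normSum hlaw hlin.measurable n) (by fun_prop)]
      refine integral_congr_ae (.of_forall fun ω => ?_)
      simp only [normSum_sum, normSum_const_mul]
      simp [PiLp.inner_apply]
    · rw [charFun_gaussianReal]
      simp [Real.coe_toNNReal _ (integral_nonneg fun x => mul_self_nonneg _)]
  · refine (tendstoInMeasure_toLp fun i => (h i).tendsto).congr_left
      fun n => .of_forall fun ω => ?_
    ext i
    simp
  · exact fun n => (WithLp.measurable_toLp 2 (ι → ℝ)).comp_aemeasurable
      (aemeasurable_pi_lambda _ fun i => (((h i).aemeasurable n).sub_const _).const_mul _)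

/-- Joint asymptotic normality of two families of asymptotically linear estimators. -/
lemma AsympLinear.asympNormalVec_sumElim {κ : Type*} [Fintype κ] [DecidableEq ι] [DecidableEq κ]
    [IsProbabilityMeasure P] [IsProbabilityMeasure μ] (hlaw : ∀ i, HasLaw (X i) P μ)
    (hindep : iIndepFun X μ) {T : ι → ℕ → Ω → ℝ} {T' : κ → ℕ → Ω → ℝ} {θ : ι → ℝ} {θ' : κ → ℝ}
    {ψ : ι → ℝ → ℝ} {ψ' : κ → ℝ → ℝ} {A : ι → ι → ℝ} {B : ι → κ → ℝ} {C : κ → ι → ℝ}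
    {D : κ → κ → ℝ}
    (h : ∀ i, AsympLinear μ P X (T i) (θ i) (ψ i))
    (h' : ∀ i, AsympLinear μ P X (T' i) (θ' i) (ψ' i))
    (hA : ∀ i j, ∫ x, ψ i x * ψ j x ∂P = A i j) (hB : ∀ i j, ∫ x, ψ i x * ψ' j x ∂P = B i j)
    (hC : ∀ i j, ∫ x, ψ' i x * ψ j x ∂P = C i j) (hD : ∀ i j, ∫ x, ψ' i x * ψ' j x ∂P = D i j) :
    AsympNormalVec μ (fun n ω => Sum.elim (fun i => T i n ω) (fun i => T' i n ω))
      (Sum.elim θ θ')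
      (Matrix.fromBlocks (Matrix.of A) (Matrix.of B) (Matrix.of C) (Matrix.of D)) := by
  have key : AsympNormalVec μ (fun n ω i => Sum.elim T T' i n ω) (Sum.elim θ θ')
      (Matrix.fromBlocks (Matrix.of A) (Matrix.of B) (Matrix.of C) (Matrix.of D)) := by
    refine AsympLinear.asympNormalVec hlaw hindep (ψ := Sum.elim ψ ψ') ?_ ?_
    · rintro (i | i)
      exacts [h i, h' i]
    · rintro (i | i) (j | j)
      exacts [hA i j, hB i j, hC i j, hD i j]
  have hT : (fun n ω => Sum.elim (fun i => T i n ω) (fun i => T' i n ω)) =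
      fun n ω i => Sum.elim T T' i n ω := by
    ext n ω (i | i) <;> rfl
  rwa [hT]

end AsympLinear

/-! ### Order statistics and sample quantiles -/

section OrderStat

variable {n : ℕ}

lemma orderStat_of_pos (hn : 0 < n) (x : Fin n → ℝ) (k : ℕ) :
    orderStat x k = (x ∘ Tuple.sort x)
      ⟨min (k - 1) (n - 1), lt_of_le_of_lt (min_le_right _ _) (Nat.sub_lt hn one_pos)⟩ := by
  simp [orderStat, hn]

lemma card_filter_comp_sort (x : Fin n → ℝ) (z : ℝ) :
    (Finset.univ.filter fun i => (x ∘ Tuple.sort x) i ≤ z).card =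
      (Finset.univ.filter fun i => x i ≤ z).card := by
  refine Finset.card_equiv (Tuple.sort x) fun i => ?_
  simp

/-- An order statistic is at most `z` exactly when enough observations are at most `z`. -/
lemma orderStat_le_iff_lt_card (hn : 0 < n) (x : Fin n → ℝ) (k : ℕ) (z : ℝ) :
    orderStat x k ≤ z ↔ min (k - 1) (n - 1) < (Finset.univ.filter fun i => x i ≤ z).card := by
  rw [orderStat_of_pos hn, ← card_filter_comp_sort,
    ← Tuple.lt_card_le_iff_apply_le_of_monotone (Tuple.monotone_sort x)]

lemma orderStat_le_iff (x : Fin n → ℝ) {k : ℕ} (hk : 1 ≤ k) (hkn : k ≤ n) (z : ℝ) :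
    orderStat x k ≤ z ↔ k ≤ (Finset.univ.filter fun i => x i ≤ z).card := by
  rw [orderStat_le_iff_lt_card (by omega)]
  omega

lemma orderStat_le_succ (x : Fin n → ℝ) (k : ℕ) : orderStat x k ≤ orderStat x (k + 1) := by
  rcases Nat.eq_zero_or_pos n with rfl | hn
  · simp [orderStat]
  · rw [orderStat_of_pos hn, orderStat_of_pos hn]
    apply Tuple.monotone_sort x
    rw [Fin.mk_le_mk]
    omega

lemma measurable_orderStat (k : ℕ) : Measurable fun x : Fin n → ℝ => orderStat x k := by
  rcases Nat.eq_zero_or_pos n with rfl | hn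
  · simp [orderStat]
  · refine measurable_of_Iic fun z => ?_
    have hcard : Measurable fun x : Fin n → ℝ => (Finset.univ.filter fun i => x i ≤ z).card := by
      simp_rw [Finset.card_filter]
      refine Finset.measurable_sum _ fun i _ => ?_
      exact Measurable.ite (measurableSet_le (measurable_pi_apply i) measurable_const)
        measurable_const measurable_const
    convert hcard (measurableSet_Ioi (a := min (k - 1) (n - 1))) using 1
    ext x
    simpa using orderStat_le_iff_lt_card hn x k z

lemma measurable_sampleQuantile (u : ℝ) :
    Measurable fun x : Fin n → ℝ => sampleQuantile x u :=
  ((measurable_orderStat _).const_mul _).add ((measurable_orderStat _).const_mul _)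

lemma orderStat_le_sampleQuantile (x : Fin n → ℝ) (u : ℝ) :
    orderStat x ⌊type8Position n u⌋₊ ≤ sampleQuantile x u := by
  have h := orderStat_le_succ x ⌊type8Position n u⌋₊
  have := Int.fract_nonneg (type8Position n u)
  unfold sampleQuantile
  nlinarith

lemma sampleQuantile_le_orderStat (x : Fin n → ℝ) (u : ℝ) :
    sampleQuantile x u ≤ orderStat x (⌊type8Position n u⌋₊ + 1) := by
  have h := orderStat_le_succ x ⌊type8Position n u⌋₊
  have := Int.fract_lt_one (type8Position n u)
  unfold sampleQuantile
  nlinarith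

/-- For a level `u ∈ (0, 1)`, the rank `⌊n u + (u + 1) / 3⌋` is eventually a rank of the sample that
is followed by another one. -/
lemma eventually_floor_type8Position {u : ℝ} (hu : u ∈ Set.Ioo (0 : ℝ) 1) :
    ∀ᶠ n : ℕ in atTop, 1 ≤ ⌊type8Position n u⌋₊ ∧ ⌊type8Position n u⌋₊ + 1 ≤ n := by
  obtain ⟨h0, h1⟩ := hu
  have h1' : 0 < 1 - u := by linarith
  filter_upwards [tendsto_natCast_atTop_atTop.eventually_ge_atTop (1 / u),
    tendsto_natCast_atTop_atTop.eventually_ge_atTop (2 / (1 - u))] with n hn hn'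
  rw [div_le_iff₀ h0] at hn
  rw [div_le_iff₀ h1'] at hn'
  constructor
  · refine Nat.le_floor ?_
    unfold type8Position
    push_cast
    linarith
  · have : (⌊type8Position n u⌋₊ : ℝ) ≤ type8Position n u :=
      Nat.floor_le (by unfold type8Position; positivity)
    have h2 : (⌊type8Position n u⌋₊ : ℝ) + 1 ≤ n := by
      unfold type8Position at this ⊢
      linarith
    exact_mod_cast h2

lemma abs_mul_sub_floor_type8Position_le {u : ℝ} (hu : u ∈ Set.Ioo (0 : ℝ) 1) (n : ℕ) :
    |n * u - ⌊type8Position n u⌋₊| ≤ 1 := by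
  obtain ⟨h0, h1⟩ := hu
  have h2 := Nat.floor_le (a := type8Position n u) (by unfold type8Position; positivity)
  have h3 := Nat.lt_floor_add_one (type8Position n u)
  unfold type8Position at *
  rw [abs_le]
  constructor <;> linarith

end OrderStat

lemma aemeasurable_empQuantile {Ω : Type*} [MeasurableSpace Ω] {μ : Measure Ω} {X : ℕ → Ω → ℝ}
    (hX : ∀ i, AEMeasurable (X i) μ) (u : ℝ) (n : ℕ) :
    AEMeasurable (fun ω => empQuantile X n ω u) μ :=
  (measurable_sampleQuantile u).comp_aemeasurable (aemeasurable_pi_lambda _ fun i => hX i)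

/-! ### Population quantiles -/

section Quantile

variable {P : Measure ℝ} {f : ℝ → ℝ} {u v : ℝ}

/-- Regularity gives continuity of the distribution function `F` at `x_u`, whence `F(x_u) = u`. -/
lemma RegularAt.cdf_quantile (hu : u ∈ Set.Ioo (0 : ℝ) 1) (h : RegularAt P f u) :
    cdf P (quantile P u) = u := by
  have hne : {x : ℝ | u ≤ cdf P x}.Nonempty :=
    ((tendsto_cdf_atTop P).eventually_const_le hu.2).exists
  have hbdd : BddBelow {x : ℝ | u ≤ cdf P x} := by
    obtain ⟨a, ha⟩ := ((tendsto_cdf_atBot P).eventually_lt_const hu.1).exists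
    refine ⟨a, fun x hx => ?_⟩
    by_contra! hlt
    exact absurd (hx.trans (monotone_cdf P hlt.le)) ha.not_ge
  have hcont : ContinuousAt (fun x => cdf P x) (quantile P u) := h.1.continuousAt
  refine le_antisymm ?_ ?_
  · refine le_of_tendsto (hcont.tendsto.mono_left (nhdsWithin_le_nhds (s := Set.Iio (quantile P u)))) ?_
    filter_upwards [self_mem_nhdsWithin] with x hx
    by_contra! hlt
    exact absurd (csInf_le hbdd hlt.le) (not_le.2 hx)
  · refine ge_of_tendsto (hcont.tendsto.mono_left (nhdsWithin_le_nhds (s := Set.Ioi (quantile P u)))) ?_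
    filter_upwards [self_mem_nhdsWithin] with x hx
    obtain ⟨y, hy, hyx⟩ := exists_lt_of_csInf_lt hne hx
    exact le_trans (show u ≤ cdf P y from hy) (monotone_cdf P hyx.le)

lemma RegularAt.quantile_lt (hu : u ∈ Set.Ioo (0 : ℝ) 1) (hv : v ∈ Set.Ioo (0 : ℝ) 1)
    (h : RegularAt P f u) (h' : RegularAt P f v) (huv : u < v) : quantile P u < quantile P v := by
  by_contra! hle
  have := monotone_cdf P hle
  rw [h.cdf_quantile hu, h'.cdf_quantile hv] at this
  exact absurd this huv.not_ge

end Quantile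

/-! ### Centred indicators -/

section CentredIndicator

/-- The centred indicator `x ↦ F(z) - 1{x ≤ z}`, where `F` is the distribution function of `P`. -/
def centredIndicator (P : Measure ℝ) (z : ℝ) (x : ℝ) : ℝ :=
  cdf P z - (Set.Iic z).indicator 1 x

variable {P : Measure ℝ}

lemma measurable_centredIndicator (z : ℝ) : Measurable (centredIndicator P z) :=
  measurable_const.sub (measurable_one.indicator measurableSet_Iic)

lemma normSum_centredIndicator {Ω : Type*} (X : ℕ → Ω → ℝ) (z : ℝ) (n : ℕ) (ω : Ω) :
    normSum X (centredIndicator P z) n ω =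
      (√(n : ℝ))⁻¹ * (n * cdf P z - (Finset.univ.filter fun i : Fin n => X i ω ≤ z).card) := by
  rw [normSum, Finset.sum_range (fun k => centredIndicator P z (X k ω))]
  simp [centredIndicator, Set.indicator_apply]

variable [IsProbabilityMeasure P]

lemma memLp_indicator_Iic (z : ℝ) : MemLp ((Set.Iic z).indicator (1 : ℝ → ℝ)) 2 P :=
  memLp_indicator_const 2 measurableSet_Iic (1 : ℝ) (Or.inr (measure_ne_top _ _))

lemma integral_indicator_Iic (z : ℝ) : ∫ x, (Set.Iic z).indicator (1 : ℝ → ℝ) x ∂P = cdf P z := by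
  rw [integral_indicator_one measurableSet_Iic, cdf_eq_real]

lemma memLp_centredIndicator (z : ℝ) : MemLp (centredIndicator P z) 2 P :=
  (memLp_const _).sub (memLp_indicator_Iic z)

lemma integral_centredIndicator (z : ℝ) : ∫ x, centredIndicator P z x ∂P = 0 := by
  simp only [centredIndicator]
  rw [integral_sub (integrable_const _) ((memLp_indicator_Iic z).integrable (by norm_num)),
    integral_indicator_Iic]
  simp

lemma integral_centredIndicator_mul (z w : ℝ) :
    ∫ x, centredIndicator P z x * centredIndicator P w x ∂P =
      cdf P (min z w) - cdf P z * cdf P w := by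
  have hI := fun y : ℝ => (memLp_indicator_Iic (P := P) y).integrable (by norm_num)
  have h : ∀ x, centredIndicator P z x * centredIndicator P w x =
      cdf P z * centredIndicator P w x - cdf P w * (Set.Iic z).indicator 1 x
        + (Set.Iic (min z w)).indicator 1 x := by
    intro x
    simp only [centredIndicator, Set.indicator_apply, Set.mem_Iic, Pi.one_apply, le_min_iff]
    split_ifs <;> first | ring1 | tauto
  simp_rw [h]
  have h1 : Integrable (fun x => cdf P z * centredIndicator P w x) P :=
    ((memLp_centredIndicator w).integrable (by norm_num)).const_mul _
  have h2 : Integrable (fun x => cdf P w * (Set.Iic z).indicator 1 x) P := (hI z).const_mul _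
  rw [integral_add (h1.sub' h2) (hI _), integral_sub h1 h2,
    integral_const_mul, integral_const_mul, integral_centredIndicator, integral_indicator_Iic,
    integral_indicator_Iic]
  ring

lemma integral_centredIndicator_sub_sq_le (z w : ℝ) :
    ∫ x, (centredIndicator P z x - centredIndicator P w x) *
      (centredIndicator P z x - centredIndicator P w x) ∂P ≤ |cdf P z - cdf P w| := by
  have hI : ∀ y y' : ℝ, Integrable (fun x => centredIndicator P y x * centredIndicator P y' x) P :=
    fun y y' => (memLp_centredIndicator y).integrable_mul (memLp_centredIndicator y')
  have h : ∀ x, (centredIndicator P z x - centredIndicator P w x) *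
      (centredIndicator P z x - centredIndicator P w x) =
      centredIndicator P z x * centredIndicator P z x
        - 2 * (centredIndicator P z x * centredIndicator P w x)
        + centredIndicator P w x * centredIndicator P w x := fun x => by ring
  simp_rw [h]
  rw [integral_add ((hI z z).sub' ((hI z w).const_mul 2)) (hI w w),
    integral_sub (hI z z) ((hI z w).const_mul 2), integral_const_mul]
  simp only [integral_centredIndicator_mul, min_self, (monotone_cdf P).map_min]
  rcases le_total (cdf P z) (cdf P w) with hle | hle
  · rw [min_eq_left hle, abs_of_nonpos (by linarith)]
    nlinarith [sq_nonneg (cdf P z - cdf P w)]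
  · rw [min_eq_right hle, abs_of_nonneg (by linarith)]
    nlinarith [sq_nonneg (cdf P z - cdf P w)]

end CentredIndicator

/-! ### Sample quantiles are asymptotically linear -/

section SampleQuantile

variable {Ω : Type*} [MeasurableSpace Ω] {μ : Measure Ω}

/-- If `W` is bounded in probability, and for each level `y` and each gap `ε` the events that `V`
and `W` lie on different sides of `y`, with `W` at distance at least `ε` from it, have vanishing
probability, then `V - W` tends to `0` in probability. -/
lemma tendstoInMeasure_sub_of_separation {V W : ℕ → Ω → ℝ} (hW : BddInProb μ W)
    (hle : ∀ y ε : ℝ, 0 < ε →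
      Tendsto (fun n => μ {ω | V n ω ≤ y ∧ y + ε ≤ W n ω}) atTop (𝓝 0))
    (hlt : ∀ y ε : ℝ, 0 < ε →
      Tendsto (fun n => μ {ω | y < V n ω ∧ W n ω ≤ y - ε}) atTop (𝓝 0)) :
    TendstoInMeasure μ (fun n ω => V n ω - W n ω) atTop 0 := by
  rw [tendstoInMeasure_zero_iff]
  intro δ hδ
  refine ENNReal.tendsto_nhds_zero.2 fun η hη => ?_
  obtain ⟨ε, hε, hδε⟩ : ∃ ε : ℝ, 0 < ε ∧ δ = 3 * ε := ⟨δ / 3, by positivity, by ring⟩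
  obtain ⟨M, hM, hWM⟩ := hW (η / 2) (ENNReal.half_pos hη.ne')
  obtain ⟨K, hK⟩ := exists_nat_ge (M / ε + 2)
  rw [← le_sub_iff_add_le, div_le_iff₀ hε] at hK
  -- When `|W| < M`, a difference of `3 ε` between `V` and `W` is detected by one of the finitely
  -- many levels `k ε` with `|k| ≤ K`.
  set A : ℕ → ℤ → Set Ω := fun n k => {ω | V n ω ≤ k * ε ∧ k * ε + ε ≤ W n ω}
  set B : ℕ → ℤ → Set Ω := fun n k => {ω | k * ε < V n ω ∧ W n ω ≤ k * ε - ε}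
  have hsum : Tendsto (fun n => ∑ k ∈ Finset.Icc (-(K : ℤ)) K, (μ (A n k) + μ (B n k)))
      atTop (𝓝 0) := by
    have := tendsto_finsetSum (Finset.Icc (-(K : ℤ)) K) fun k _ =>
      (hle (k * ε) ε hε).add (hlt (k * ε) ε hε)
    simpa using this
  filter_upwards [hWM, ENNReal.tendsto_nhds_zero.1 hsum (η / 2) (ENNReal.half_pos hη.ne')]
    with n h1 h2
  have hsub : {ω | δ ≤ |V n ω - W n ω|} ⊆
      {ω | M ≤ |W n ω|} ∪ ⋃ k ∈ Finset.Icc (-(K : ℤ)) K, (A n k ∪ B n k) := by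
    intro ω hω
    rw [Set.mem_ofPred_eq, hδε] at hω
    by_cases hMW : M ≤ |W n ω|
    · exact Or.inl hMW
    right
    obtain ⟨hW1, hW2⟩ := abs_lt.1 (not_le.1 hMW)
    simp only [Set.mem_iUnion, Finset.mem_Icc, exists_prop]
    have hfl := Int.floor_le (W n ω / ε)
    have hfl' := Int.lt_floor_add_one (W n ω / ε)
    set k := ⌊W n ω / ε⌋
    rw [le_div_iff₀ hε] at hfl
    rw [div_lt_iff₀ hε] at hfl'
    have hk1 : (k : ℝ) < K - 2 := by nlinarith
    have hk2 : -(K : ℝ) + 1 < k := by nlinarith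
    have hk1' : k < K - 2 := by exact_mod_cast hk1
    have hk2' : -(K : ℤ) + 1 < k := by exact_mod_cast hk2
    rcases le_abs.1 hω with h | h
    · refine ⟨k + 2, ⟨by omega, by omega⟩, Or.inr ⟨?_, ?_⟩⟩
      · push_cast; nlinarith
      · push_cast; nlinarith
    · refine ⟨k - 1, ⟨by omega, by omega⟩, Or.inl ⟨?_, ?_⟩⟩
      · push_cast; nlinarith
      · push_cast; nlinarith
  calc μ {ω | δ ≤ |V n ω - W n ω|}
      ≤ μ {ω | M ≤ |W n ω|} + μ (⋃ k ∈ Finset.Icc (-(K : ℤ)) K, (A n k ∪ B n k)) :=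
        (measure_mono hsub).trans (measure_union_le _ _)
    _ ≤ η / 2 + ∑ k ∈ Finset.Icc (-(K : ℤ)) K, (μ (A n k) + μ (B n k)) :=
        add_le_add h1 ((measure_biUnion_finset_le _ _).trans
          (Finset.sum_le_sum fun k _ => measure_union_le _ _))
    _ ≤ η / 2 + η / 2 := by gcongr
    _ = η := ENNReal.add_halves η

variable {P : Measure ℝ} {f : ℝ → ℝ} {u : ℝ} {X : ℕ → Ω → ℝ}

/-- The influence function `x ↦ h(u) (F(x_u) - 1{x ≤ x_u})` of the `u`-th sample quantile. -/
def quantileInfluence (P : Measure ℝ) (f : ℝ → ℝ) (u x : ℝ) : ℝ :=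
  quantileDensity P f u * centredIndicator P (quantile P u) x

/-- With `z = x_u + y / √n` and `j = ⌊n u + (u + 1) / 3⌋`, the threshold `h(u) √n (F(z) - j / n)`,
at which the centred empirical distribution function at `z` decides whether at least `j`
observations are at most `z`, tends to `y`. -/
lemma RegularAt.tendsto_rescaled_rank (hu : u ∈ Set.Ioo (0 : ℝ) 1) (h : RegularAt P f u) (y : ℝ) :
    Tendsto (fun n : ℕ => quantileDensity P f u * ((√(n : ℝ))⁻¹ *
      (n * cdf P (quantile P u + (√(n : ℝ))⁻¹ * y) - ⌊type8Position n u⌋₊))) atTop (𝓝 y) := by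
  have hsqrt : Tendsto (fun n : ℕ => √(n : ℝ)) atTop atTop :=
    Real.tendsto_sqrt_atTop.comp tendsto_natCast_atTop_atTop
  have h1 := (h.1.hasFDerivAt.lim_real y).comp hsqrt
  have h2 : Tendsto (fun n : ℕ => (√(n : ℝ))⁻¹ * (n * u - ⌊type8Position n u⌋₊)) atTop (𝓝 0) := by
    refine squeeze_zero_norm (fun n => ?_) (tendsto_inv_atTop_zero.comp hsqrt)
    rw [norm_mul, Real.norm_eq_abs, Real.norm_eq_abs, abs_of_nonneg (by positivity)]
    exact mul_le_of_le_one_right (by positivity) (abs_mul_sub_floor_type8Position_le hu n)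
  have h3 := (h1.add h2).const_mul (quantileDensity P f u)
  have hlim : quantileDensity P f u * ((ContinuousLinearMap.toSpanSingleton ℝ
      (f (quantile P u))) y + 0) = y := by
    have := h.2.ne'
    simp [quantileDensity]
    field_simp
  rw [hlim] at h3
  refine h3.congr' ?_
  filter_upwards [eventually_gt_atTop 0] with n hn
  have hn' : (0 : ℝ) < √(n : ℝ) := Real.sqrt_pos.2 (by exact_mod_cast hn)
  have hsq : (n : ℝ) = √(n : ℝ) * √(n : ℝ) := (Real.mul_self_sqrt (Nat.cast_nonneg n)).symm
  simp only [Function.comp_apply, smul_eq_mul, h.cdf_quantile hu]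
  have hinv : (√(n : ℝ))⁻¹ * n = √(n : ℝ) := by
    rw [inv_mul_eq_iff_eq_mul₀ hn'.ne']; exact hsq
  linear_combination (-quantileDensity P f u *
    (cdf P (quantile P u + (√(n : ℝ))⁻¹ * y) - u)) * hinv

variable [IsProbabilityMeasure μ] [IsProbabilityMeasure P]

/-- Stochastic equicontinuity of the empirical process: it varies little between `z` and points
`w n` at which the distribution function tends to its value at `z`. -/
lemma tendstoInMeasure_normSum_centredIndicator_sub (hlaw : ∀ i, HasLaw (X i) P μ)
    (hindep : iIndepFun X μ) {z : ℝ} {w : ℕ → ℝ}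
    (hw : Tendsto (fun n => cdf P (w n)) atTop (𝓝 (cdf P z))) :
    TendstoInMeasure μ (fun n ω =>
      normSum X (centredIndicator P z) n ω - normSum X (centredIndicator P (w n)) n ω)
      atTop 0 := by
  rw [tendstoInMeasure_zero_iff]
  intro ε hε
  have hlim : Tendsto (fun n => ENNReal.ofReal (|cdf P z - cdf P (w n)| / ε ^ 2)) atTop (𝓝 0) := by
    have := ENNReal.tendsto_ofReal (((tendsto_const_nhds (x := cdf P z)).sub hw).abs.div_const
      (ε ^ 2))
    simpa using this
  refine tendsto_of_tendsto_of_tendsto_of_le_of_le tendsto_const_nhds hlim (fun _ => zero_le) ?_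
  intro n
  have h0 : ∫ x, (centredIndicator P z x - centredIndicator P (w n) x) ∂P = 0 := by
    rw [integral_sub ((memLp_centredIndicator _).integrable (by norm_num))
      ((memLp_centredIndicator _).integrable (by norm_num)), integral_centredIndicator,
      integral_centredIndicator, sub_zero]
  have h := measure_normSum_ge_le hlaw hindep (n := n)
    (ψ := fun x => centredIndicator P z x - centredIndicator P (w n) x)
    ((measurable_centredIndicator (P := P) z).sub (measurable_centredIndicator (w n)))
    ((memLp_centredIndicator z).sub (memLp_centredIndicator (w n))) h0 hε
  simp only [normSum_sub] at h
  refine h.trans (ENNReal.ofReal_le_ofReal ?_)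
  gcongr
  exact integral_centredIndicator_sub_sq_le _ _

/-- The Bahadur representation of a sample quantile at a regular level, with a remainder that tends
to `0` in probability. -/
theorem RegularAt.asympLinear_empQuantile (hlaw : ∀ i, HasLaw (X i) P μ) (hindep : iIndepFun X μ)
    (hu : u ∈ Set.Ioo (0 : ℝ) 1) (h : RegularAt P f u) :
    AsympLinear μ P X (fun n ω => empQuantile X n ω u) (quantile P u)
      (quantileInfluence P f u) := by
  have hmeas : Measurable (quantileInfluence P f u) :=
    (measurable_centredIndicator _).const_mul _
  have hmem : MemLp (quantileInfluence P f u) 2 P := (memLp_centredIndicator _).const_mul _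
  have hzero : ∫ x, quantileInfluence P f u x ∂P = 0 := by
    simp only [quantileInfluence]
    rw [integral_const_mul, integral_centredIndicator, mul_zero]
  have hh : 0 < quantileDensity P f u := one_div_pos.2 h.2
  refine ⟨aemeasurable_empQuantile (fun i => (hlaw i).aemeasurable) u, hmeas, hmem, hzero, ?_⟩
  -- `D y` is the change of the linear term when `x_u` is replaced by `x_u + y / √n`.
  set w : ℝ → ℕ → ℝ := fun y n => quantile P u + (√(n : ℝ))⁻¹ * y with hw_def
  set D : ℝ → ℕ → Ω → ℝ := fun y n ω => quantileDensity P f u *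
    (normSum X (centredIndicator P (quantile P u)) n ω
      - normSum X (centredIndicator P (w y n)) n ω) with hD_def
  have hD : ∀ y, TendstoInMeasure μ (D y) atTop 0 := by
    intro y
    refine tendstoInMeasure_zero_const_mul _
      (tendstoInMeasure_normSum_centredIndicator_sub hlaw hindep ?_)
    have hsqrt : Tendsto (fun n : ℕ => √(n : ℝ)) atTop atTop :=
      Real.tendsto_sqrt_atTop.comp tendsto_natCast_atTop_atTop
    have hw : Tendsto (w y) atTop (𝓝 (quantile P u)) := by
      simpa using tendsto_const_nhds.add ((tendsto_inv_atTop_zero.comp hsqrt).mul_const y)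
    exact h.1.continuousAt.tendsto.comp hw
  have hW : ∀ n ω, normSum X (quantileInfluence P f u) n ω =
      quantileDensity P f u * normSum X (centredIndicator P (quantile P u)) n ω :=
    fun n ω => normSum_const_mul X _ _ n ω
  have hV : ∀ n : ℕ, 0 < n → ∀ ω (y : ℝ),
      √(n : ℝ) * (empQuantile X n ω u - quantile P u) ≤ y ↔ empQuantile X n ω u ≤ w y n := by
    intro n hn ω y
    have hn' : (0 : ℝ) < √(n : ℝ) := Real.sqrt_pos.2 (by exact_mod_cast hn)
    rw [← le_div_iff₀' hn', div_eq_inv_mul, sub_le_iff_le_add']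
  -- If `V ≤ y`, at least `⌊n u + (u + 1) / 3⌋` observations are at most `w y n`, so the linear term at
  -- `w y n` is at most a threshold close to `y`, and `W ≥ y + ε` makes `D y` large; if `y < V`, the
  -- inequalities are reversed.
  refine tendstoInMeasure_sub_of_separation (bddInProb_normSum hlaw hindep hmeas hmem hzero)
    (fun y ε hε => ?_) (fun y ε hε => ?_)
  · refine tendsto_of_tendsto_of_tendsto_of_le_of_le' tendsto_const_nhds
      (tendstoInMeasure_zero_iff.1 (hD y) (ε / 2) (by positivity)) (.of_forall fun _ => zero_le) ?_
    filter_upwards [eventually_gt_atTop 0, eventually_floor_type8Position hu,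
      (h.tendsto_rescaled_rank hu y).eventually_le_const (show y < y + ε / 2 by linarith)]
      with n hn hrank hy
    refine measure_mono fun ω hω => ?_
    obtain ⟨h1, h2⟩ := hω
    rw [hV n hn] at h1
    have hcard := (orderStat_le_iff _ hrank.1 (by omega) _).1
      ((orderStat_le_sampleQuantile _ u).trans h1)
    have hcard' : ((⌊type8Position n u⌋₊ : ℕ) : ℝ) ≤
        ((Finset.univ.filter fun i : Fin n => X i ω ≤ w y n).card : ℝ) := by exact_mod_cast hcard
    have h3 : quantileDensity P f u * normSum X (centredIndicator P (w y n)) n ω ≤ y + ε / 2 := by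
      refine le_trans ?_ hy
      rw [normSum_centredIndicator]
      gcongr
    rw [hW] at h2
    refine le_trans (b := D y n ω) ?_ (le_abs_self _)
    simp only [hD_def]
    linarith
  · refine tendsto_of_tendsto_of_tendsto_of_le_of_le' tendsto_const_nhds
      (tendstoInMeasure_zero_iff.1 (hD y) (ε / 2) (by positivity)) (.of_forall fun _ => zero_le) ?_
    filter_upwards [eventually_gt_atTop 0, eventually_floor_type8Position hu,
      (h.tendsto_rescaled_rank hu y).eventually_const_le (show y - ε / 2 < y by linarith)]
      with n hn hrank hy
    refine measure_mono fun ω hω => ?_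
    obtain ⟨h1, h2⟩ := hω
    rw [← not_le, hV n hn, not_le] at h1
    have hcard := mt (orderStat_le_iff _ (by omega) hrank.2 _).2
      (h1.trans_le (sampleQuantile_le_orderStat _ u)).not_ge
    have hcard' : ((Finset.univ.filter fun i : Fin n => X i ω ≤ w y n).card : ℝ) ≤
        ((⌊type8Position n u⌋₊ : ℕ) : ℝ) := by
      exact_mod_cast Nat.lt_succ_iff.1 (not_le.1 hcard)
    have h3 : y - ε / 2 ≤ quantileDensity P f u * normSum X (centredIndicator P (w y n)) n ω := by
      refine le_trans hy ?_
      rw [normSum_centredIndicator]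
      gcongr
    rw [hW] at h2
    refine le_trans (b := -D y n ω) ?_ (neg_le_abs _)
    simp only [hD_def]
    linarith

/-- The covariance of the influence functions of two sample quantiles. -/
lemma integral_quantileInfluence_mul {v : ℝ} (hu : u ∈ Set.Ioo (0 : ℝ) 1)
    (hv : v ∈ Set.Ioo (0 : ℝ) 1) (h : RegularAt P f u) (h' : RegularAt P f v) :
    ∫ x, quantileInfluence P f u x * quantileInfluence P f v x ∂P = xi P f u v := by
  have hmul : ∀ x, quantileInfluence P f u x * quantileInfluence P f v x =
      quantileDensity P f u * quantileDensity P f v *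
        (centredIndicator P (quantile P u) x * centredIndicator P (quantile P v) x) :=
    fun x => mul_mul_mul_comm _ _ _ _
  simp_rw [hmul]
  rw [integral_const_mul, integral_centredIndicator_mul, (monotone_cdf P).map_min,
    h.cdf_quantile hu, h'.cdf_quantile hv, xi]
  linear_combination (quantileDensity P f u * quantileDensity P f v) * min_mul_max u v

end SampleQuantile

/-! ### Covariances of the skewness measures -/

section Covariance

/-- `1/2`, `p` and `1 - p` are regular levels, where `0 < p < 1/2`. -/
structure RegularTriple (P : Measure ℝ) (f : ℝ → ℝ) (p : ℝ) : Prop where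
  mem_Ioo : p ∈ Set.Ioo (0 : ℝ) (1 / 2)
  half : RegularAt P f (1 / 2)
  lower : RegularAt P f p
  upper : RegularAt P f (1 - p)

lemma half_mem_Ioo : (1 / 2 : ℝ) ∈ Set.Ioo (0 : ℝ) 1 := by norm_num

variable {P : Measure ℝ} {f : ℝ → ℝ} {p q : ℝ}

namespace RegularTriple

lemma lower_mem_Ioo (h : RegularTriple P f p) : p ∈ Set.Ioo (0 : ℝ) 1 :=
  ⟨h.mem_Ioo.1, by linarith [h.mem_Ioo.2]⟩

lemma upper_mem_Ioo (h : RegularTriple P f p) : 1 - p ∈ Set.Ioo (0 : ℝ) 1 :=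
  ⟨by linarith [h.mem_Ioo.2], by linarith [h.mem_Ioo.1]⟩

lemma rangeR1_pos (h : RegularTriple P f p) : 0 < rangeR1 (quantile P) p :=
  sub_pos.2 (h.lower.quantile_lt h.lower_mem_Ioo h.upper_mem_Ioo h.upper
    (by linarith [h.mem_Ioo.2]))

lemma rangeR2_pos (h : RegularTriple P f p) : 0 < rangeR2 (quantile P) p :=
  sub_pos.2 (h.lower.quantile_lt h.lower_mem_Ioo half_mem_Ioo h.half h.mem_Ioo.2)

end RegularTriple

/-- The influence function of the estimator `L (x̂)` of `L (x)`, for a linear functional `L` of the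
quantile function such as `skewS · p`, `rangeR1 · p` and `rangeR2 · p`. -/
def functionalInfluence (P : Measure ℝ) (f : ℝ → ℝ) (L : (ℝ → ℝ) → ℝ) (x : ℝ) : ℝ :=
  L fun u => quantileInfluence P f u x

/-- The influence function of an estimator of the quotient `L / M` of two linear functionals of the
quantile function. -/
def quotientInfluence (P : Measure ℝ) (f : ℝ → ℝ) (L M : (ℝ → ℝ) → ℝ) (x : ℝ) : ℝ :=
  (M (quantile P))⁻¹ * (functionalInfluence P f L x
    - L (quantile P) / M (quantile P) * functionalInfluence P f M x)

lemma skewS_eq_sum (Q : ℝ → ℝ) (p : ℝ) :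
    skewS Q p = ∑ a : Fin 3, ![1, 1, -2] a * Q (![1 - p, p, 1 / 2] a) := by
  simp [skewS, Fin.sum_univ_three]; ring

lemma rangeR1_eq_sum (Q : ℝ → ℝ) (p : ℝ) :
    rangeR1 Q p = ∑ a : Fin 2, ![1, -1] a * Q (![1 - p, p] a) := by
  simp [rangeR1]; ring

lemma rangeR2_eq_sum (Q : ℝ → ℝ) (p : ℝ) :
    rangeR2 Q p = ∑ a : Fin 2, ![1, -1] a * Q (![1 / 2, p] a) := by
  simp [rangeR2]; ring

lemma xi_comm (u v : ℝ) : xi P f u v = xi P f v u := by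
  simp only [xi, min_comm u v, max_comm u v]; ring

lemma covR1S_self (p : ℝ) : covR1S P f p p = covSR1 P f p p := by
  simp only [covR1S, covSR1, xi_comm (1 / 2) (1 - p), xi_comm (1 / 2) p, xi_comm p (1 - p)]; ring

lemma covR2S_self (p : ℝ) : covR2S P f p p = covSR2 P f p p := by
  simp only [covR2S, covSR2, xi_comm (1 / 2) (1 - p), xi_comm (1 / 2) p, xi_comm p (1 - p)]; ring

lemma sigma1_self (hS : skewS (quantile P) p ≠ 0) (hR : rangeR1 (quantile P) p ≠ 0) :
    sigma1 P f p p = skewGamma (quantile P) p ^ 2 *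
      (covSS P f p p / skewS (quantile P) p ^ 2 + covR1R1 P f p p / rangeR1 (quantile P) p ^ 2
        - 2 * covSR1 P f p p / (skewS (quantile P) p * rangeR1 (quantile P) p)) := by
  simp only [sigma1, skewGamma, covR1S_self]
  field_simp
  ring

lemma sigma2_self (hS : skewS (quantile P) p ≠ 0) (hR : rangeR2 (quantile P) p ≠ 0) :
    sigma2 P f p p = skewLambda (quantile P) p ^ 2 *
      (covSS P f p p / skewS (quantile P) p ^ 2 + covR2R2 P f p p / rangeR2 (quantile P) p ^ 2
        - 2 * covSR2 P f p p / (skewS (quantile P) p * rangeR2 (quantile P) p)) := by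
  simp only [sigma2, skewLambda, covR2S_self]
  field_simp
  ring

lemma gridPoint_mem_Ioo {J j : ℕ} (hj : j ∈ Finset.Icc 1 J) :
    gridPoint J j ∈ Set.Ioo (0 : ℝ) (1 / 2) := by
  obtain ⟨h1, h2⟩ := Finset.mem_Icc.1 hj
  have h1' : (1 : ℝ) ≤ j := by exact_mod_cast h1
  have h2' : (j : ℝ) ≤ J := by exact_mod_cast h2
  have hJ : (0 : ℝ) < J := by linarith
  unfold gridPoint
  constructor
  · have : (0 : ℝ) < j - 1 / 2 := by linarith
    positivity
  · rw [div_lt_iff₀ hJ]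
    linarith

lemma RegularTriple.regular_three (hp : RegularTriple P f p) (i : Fin 3) :
    ![1 - p, p, 1 / 2] i ∈ Set.Ioo (0 : ℝ) 1 ∧ RegularAt P f (![1 - p, p, 1 / 2] i) := by
  fin_cases i
  exacts [⟨hp.upper_mem_Ioo, hp.upper⟩, ⟨hp.lower_mem_Ioo, hp.lower⟩, ⟨half_mem_Ioo, hp.half⟩]

lemma RegularTriple.regular_outer (hp : RegularTriple P f p) (i : Fin 2) :
    ![1 - p, p] i ∈ Set.Ioo (0 : ℝ) 1 ∧ RegularAt P f (![1 - p, p] i) := by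
  fin_cases i
  exacts [⟨hp.upper_mem_Ioo, hp.upper⟩, ⟨hp.lower_mem_Ioo, hp.lower⟩]

lemma RegularTriple.regular_lower (hp : RegularTriple P f p) (i : Fin 2) :
    ![1 / 2, p] i ∈ Set.Ioo (0 : ℝ) 1 ∧ RegularAt P f (![1 / 2, p] i) := by
  fin_cases i
  exacts [⟨half_mem_Ioo, hp.half⟩, ⟨hp.lower_mem_Ioo, hp.lower⟩]

lemma integral_quotientInfluence_mul {L M L' M' : (ℝ → ℝ) → ℝ}
    (hL : MemLp (functionalInfluence P f L) 2 P) (hM : MemLp (functionalInfluence P f M) 2 P)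
    (hL' : MemLp (functionalInfluence P f L') 2 P)
    (hM' : MemLp (functionalInfluence P f M') 2 P) :
    ∫ x, quotientInfluence P f L M x * quotientInfluence P f L' M' x ∂P =
      1 / (M (quantile P) * M' (quantile P)) *
        (∫ x, functionalInfluence P f L x * functionalInfluence P f L' x ∂P
          - L' (quantile P) / M' (quantile P) *
            ∫ x, functionalInfluence P f L x * functionalInfluence P f M' x ∂P
          - L (quantile P) / M (quantile P) *
            ∫ x, functionalInfluence P f M x * functionalInfluence P f L' x ∂P
          + L (quantile P) / M (quantile P) * (L' (quantile P) / M' (quantile P)) *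
            ∫ x, functionalInfluence P f M x * functionalInfluence P f M' x ∂P) := by
  have hsum : ∀ (N K : (ℝ → ℝ) → ℝ) (x : ℝ), quotientInfluence P f N K x =
      ∑ i : Fin 2, ![(K (quantile P))⁻¹, -((K (quantile P))⁻¹ * (N (quantile P) / K (quantile P)))] i
        * ![functionalInfluence P f N, functionalInfluence P f K] i x := by
    intro N K x
    simp [quotientInfluence]
    ring
  simp_rw [hsum]
  rw [integral_sum_mul_sum]
  · simp only [Fin.sum_univ_two, Matrix.cons_val_zero, Matrix.cons_val_one]
    rw [one_div, mul_inv]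
    ring
  · intro i _
    fin_cases i
    exacts [hL, hM]
  · intro i _
    fin_cases i
    exacts [hL', hM']

variable [IsProbabilityMeasure P]

lemma memLp_quantileInfluence (u : ℝ) : MemLp (quantileInfluence P f u) 2 P :=
  (memLp_centredIndicator _).const_mul _

lemma integral_quantileInfluence_comb_mul {k l : ℕ} {u : Fin k → ℝ} {v : Fin l → ℝ}
    (hu : ∀ i, u i ∈ Set.Ioo (0 : ℝ) 1 ∧ RegularAt P f (u i))
    (hv : ∀ i, v i ∈ Set.Ioo (0 : ℝ) 1 ∧ RegularAt P f (v i)) (c : Fin k → ℝ) (d : Fin l → ℝ) :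
    ∫ x, (∑ i, c i * quantileInfluence P f (u i) x) * (∑ j, d j * quantileInfluence P f (v j) x) ∂P
      = ∑ i, ∑ j, c i * d j * xi P f (u i) (v j) := by
  rw [integral_sum_mul_sum _ _ (fun i _ => memLp_quantileInfluence (u i))
    (fun j _ => memLp_quantileInfluence (v j))]
  refine Finset.sum_congr rfl fun i _ => Finset.sum_congr rfl fun j _ => ?_
  rw [integral_quantileInfluence_mul (hu i).1 (hv j).1 (hu i).2 (hv j).2]

section

variable (hp : RegularTriple P f p) (hq : RegularTriple P f q)
include hp hq

lemma integral_influence_skewS_mul_skewS :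
    ∫ x, functionalInfluence P f (skewS · p) x * functionalInfluence P f (skewS · q) x ∂P =
      covSS P f p q := by
  simp only [functionalInfluence, skewS_eq_sum]
  rw [integral_quantileInfluence_comb_mul hp.regular_three hq.regular_three]
  simp [Fin.sum_univ_three, covSS]
  ring

lemma integral_influence_skewS_mul_rangeR1 :
    ∫ x, functionalInfluence P f (skewS · p) x * functionalInfluence P f (rangeR1 · q) x ∂P =
      covSR1 P f p q := by
  simp only [functionalInfluence, skewS_eq_sum, rangeR1_eq_sum]
  rw [integral_quantileInfluence_comb_mul hp.regular_three hq.regular_outer]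
  simp [Fin.sum_univ_three, covSR1]
  ring

lemma integral_influence_rangeR1_mul_skewS :
    ∫ x, functionalInfluence P f (rangeR1 · p) x * functionalInfluence P f (skewS · q) x ∂P =
      covR1S P f p q := by
  simp only [functionalInfluence, skewS_eq_sum, rangeR1_eq_sum]
  rw [integral_quantileInfluence_comb_mul hp.regular_outer hq.regular_three]
  simp [Fin.sum_univ_three, covR1S]
  ring

lemma integral_influence_rangeR1_mul_rangeR1 :
    ∫ x, functionalInfluence P f (rangeR1 · p) x * functionalInfluence P f (rangeR1 · q) x ∂P =
      covR1R1 P f p q := by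
  simp only [functionalInfluence, rangeR1_eq_sum]
  rw [integral_quantileInfluence_comb_mul hp.regular_outer hq.regular_outer]
  simp [covR1R1]
  ring

lemma integral_influence_skewS_mul_rangeR2 :
    ∫ x, functionalInfluence P f (skewS · p) x * functionalInfluence P f (rangeR2 · q) x ∂P =
      covSR2 P f p q := by
  simp only [functionalInfluence, skewS_eq_sum, rangeR2_eq_sum]
  rw [integral_quantileInfluence_comb_mul hp.regular_three hq.regular_lower]
  simp [Fin.sum_univ_three, covSR2]
  ring

lemma integral_influence_rangeR2_mul_skewS :
    ∫ x, functionalInfluence P f (rangeR2 · p) x * functionalInfluence P f (skewS · q) x ∂P =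
      covR2S P f p q := by
  simp only [functionalInfluence, skewS_eq_sum, rangeR2_eq_sum]
  rw [integral_quantileInfluence_comb_mul hp.regular_lower hq.regular_three]
  simp [Fin.sum_univ_three, covR2S]
  ring

lemma integral_influence_rangeR2_mul_rangeR2 :
    ∫ x, functionalInfluence P f (rangeR2 · p) x * functionalInfluence P f (rangeR2 · q) x ∂P =
      covR2R2 P f p q := by
  simp only [functionalInfluence, rangeR2_eq_sum]
  rw [integral_quantileInfluence_comb_mul hp.regular_lower hq.regular_lower]
  simp [covR2R2]
  ring

end

end Covariance

/-! ### Asymptotic linearity of the skewness estimators -/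

section Estimators

variable {Ω : Type*} [MeasurableSpace Ω] {μ : Measure Ω} [IsProbabilityMeasure μ]
  {P : Measure ℝ} [IsProbabilityMeasure P] {f : ℝ → ℝ} {X : ℕ → Ω → ℝ}

section

variable (hlaw : ∀ i, HasLaw (X i) P μ) (hindep : iIndepFun X μ) {p q : ℝ}
  (hp : RegularTriple P f p) (hq : RegularTriple P f q)
include hlaw hindep hp

lemma RegularTriple.asympLinear_skewS :
    AsympLinear μ P X (fun n ω => skewS (empQuantile X n ω) p) (skewS (quantile P) p)
      (functionalInfluence P f (skewS · p)) :=
  ((hp.upper.asympLinear_empQuantile hlaw hindep hp.upper_mem_Ioo).add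
    (hp.lower.asympLinear_empQuantile hlaw hindep hp.lower_mem_Ioo)).sub
    ((hp.half.asympLinear_empQuantile hlaw hindep half_mem_Ioo).const_mul 2)

lemma RegularTriple.asympLinear_rangeR1 :
    AsympLinear μ P X (fun n ω => rangeR1 (empQuantile X n ω) p) (rangeR1 (quantile P) p)
      (functionalInfluence P f (rangeR1 · p)) :=
  (hp.upper.asympLinear_empQuantile hlaw hindep hp.upper_mem_Ioo).sub
    (hp.lower.asympLinear_empQuantile hlaw hindep hp.lower_mem_Ioo)

lemma RegularTriple.asympLinear_rangeR2 :
    AsympLinear μ P X (fun n ω => rangeR2 (empQuantile X n ω) p) (rangeR2 (quantile P) p)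
      (functionalInfluence P f (rangeR2 · p)) :=
  (hp.half.asympLinear_empQuantile hlaw hindep half_mem_Ioo).sub
    (hp.lower.asympLinear_empQuantile hlaw hindep hp.lower_mem_Ioo)

lemma RegularTriple.asympLinear_skewGamma :
    AsympLinear μ P X (fun n ω => skewGamma (empQuantile X n ω) p) (skewGamma (quantile P) p)
      (quotientInfluence P f (skewS · p) (rangeR1 · p)) :=
  (hp.asympLinear_skewS hlaw hindep).div hlaw hindep (hp.asympLinear_rangeR1 hlaw hindep)
    hp.rangeR1_pos.ne'

lemma RegularTriple.asympLinear_skewLambda :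
    AsympLinear μ P X (fun n ω => skewLambda (empQuantile X n ω) p) (skewLambda (quantile P) p)
      (quotientInfluence P f (skewS · p) (rangeR2 · p)) :=
  (hp.asympLinear_skewS hlaw hindep).div hlaw hindep (hp.asympLinear_rangeR2 hlaw hindep)
    hp.rangeR2_pos.ne'

include hq

lemma integral_influence_skewGamma_mul :
    ∫ x, quotientInfluence P f (skewS · p) (rangeR1 · p) x *
      quotientInfluence P f (skewS · q) (rangeR1 · q) x ∂P = sigma1 P f p q := by
  rw [integral_quotientInfluence_mul (hp.asympLinear_skewS hlaw hindep).memLp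
    (hp.asympLinear_rangeR1 hlaw hindep).memLp (hq.asympLinear_skewS hlaw hindep).memLp
    (hq.asympLinear_rangeR1 hlaw hindep).memLp, integral_influence_skewS_mul_skewS hp hq,
    integral_influence_skewS_mul_rangeR1 hp hq, integral_influence_rangeR1_mul_skewS hp hq,
    integral_influence_rangeR1_mul_rangeR1 hp hq]
  rfl

lemma integral_influence_skewLambda_mul :
    ∫ x, quotientInfluence P f (skewS · p) (rangeR2 · p) x *
      quotientInfluence P f (skewS · q) (rangeR2 · q) x ∂P = sigma2 P f p q := by
  rw [integral_quotientInfluence_mul (hp.asympLinear_skewS hlaw hindep).memLp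
    (hp.asympLinear_rangeR2 hlaw hindep).memLp (hq.asympLinear_skewS hlaw hindep).memLp
    (hq.asympLinear_rangeR2 hlaw hindep).memLp, integral_influence_skewS_mul_skewS hp hq,
    integral_influence_skewS_mul_rangeR2 hp hq, integral_influence_rangeR2_mul_skewS hp hq,
    integral_influence_rangeR2_mul_rangeR2 hp hq]
  rfl

end

/-- A weighted Riemann sum of asymptotically linear estimators is asymptotically normal. -/
lemma asympNormal_aucSum (hlaw : ∀ i, HasLaw (X i) P μ) (hindep : iIndepFun X μ) {J : ℕ}
    {T : ℝ → ℕ → Ω → ℝ} {θ : ℝ → ℝ} {ψ σ : ℝ → ℝ → ℝ} (w : ℝ → ℝ)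
    (h : ∀ j ∈ Finset.Icc 1 J,
      AsympLinear μ P X (T (gridPoint J j)) (θ (gridPoint J j)) (ψ (gridPoint J j)))
    (hσ : ∀ j ∈ Finset.Icc 1 J, ∀ k ∈ Finset.Icc 1 J,
      ∫ x, ψ (gridPoint J j) x * ψ (gridPoint J k) x ∂P = σ (gridPoint J j) (gridPoint J k)) :
    AsympNormal μ (fun n ω => aucSum J fun p => w p * T p n ω) (aucSum J fun p => w p * θ p)
      (1 / (J : ℝ) ^ 2 * ∑ j ∈ Finset.Icc 1 J, ∑ k ∈ Finset.Icc 1 J,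
        w (gridPoint J j) * w (gridPoint J k) * σ (gridPoint J j) (gridPoint J k)) := by
  refine ((AsympLinear.sum (Finset.Icc 1 J) fun j hj =>
    (h j hj).const_mul (w (gridPoint J j))).const_mul (1 / (J : ℝ))).asympNormal hlaw hindep ?_
  simp_rw [mul_mul_mul_comm (1 / (J : ℝ)) _ (1 / (J : ℝ)) _]
  rw [integral_const_mul, integral_sum_mul_sum _ _ (fun j hj => (h j hj).memLp)
    (fun j hj => (h j hj).memLp)]
  congr 1
  · ring
  · refine Finset.sum_congr rfl fun j hj => Finset.sum_congr rfl fun k hk => ?_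
    rw [hσ j hj k hk]

end Estimators

end

theorem mainTheorem2
    {Ω : Type*} [MeasurableSpace Ω] (μ : Measure Ω) [IsProbabilityMeasure μ]
    (P : Measure ℝ) [IsProbabilityMeasure P] (f : ℝ → ℝ)
    (X : ℕ → Ω → ℝ) (hlaw : ∀ i, HasLaw (X i) P μ) (hindep : iIndepFun X μ) :
    -- sample quantiles at finitely many levels
    (∀ (m : ℕ) (u : Fin m → ℝ), (∀ i, u i ∈ Set.Ioo (0 : ℝ) 1) → (∀ i, RegularAt P f (u i)) →
      AsympNormalVec μ (fun n ω i => empQuantile X n ω (u i)) (fun i => quantile P (u i))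
        (Matrix.of fun i j => xi P f (u i) (u j))) ∧
    -- numerators, denominators and skewness coefficients at finitely many levels
    (∀ (m : ℕ) (p : Fin m → ℝ), (∀ i, p i ∈ Set.Ioo (0 : ℝ) (1 / 2)) →
      RegularAt P f (1 / 2) → (∀ i, RegularAt P f (p i)) → (∀ i, RegularAt P f (1 - p i)) →
      AsympNormalVec μ
        (fun n ω => Sum.elim (fun i => skewS (empQuantile X n ω) (p i))
          (fun i => rangeR1 (empQuantile X n ω) (p i)))
        (Sum.elim (fun i => skewS (quantile P) (p i)) (fun i => rangeR1 (quantile P) (p i)))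
        (Matrix.fromBlocks
          (Matrix.of fun i j => covSS P f (p i) (p j)) (Matrix.of fun i j => covSR1 P f (p i) (p j))
          (Matrix.of fun i j => covR1S P f (p i) (p j))
          (Matrix.of fun i j => covR1R1 P f (p i) (p j))) ∧
      AsympNormalVec μ
        (fun n ω => Sum.elim (fun i => skewS (empQuantile X n ω) (p i))
          (fun i => rangeR2 (empQuantile X n ω) (p i)))
        (Sum.elim (fun i => skewS (quantile P) (p i)) (fun i => rangeR2 (quantile P) (p i)))
        (Matrix.fromBlocks
          (Matrix.of fun i j => covSS P f (p i) (p j)) (Matrix.of fun i j => covSR2 P f (p i) (p j))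
          (Matrix.of fun i j => covR2S P f (p i) (p j))
          (Matrix.of fun i j => covR2R2 P f (p i) (p j))) ∧
      AsympNormalVec μ (fun n ω i => skewGamma (empQuantile X n ω) (p i))
        (fun i => skewGamma (quantile P) (p i)) (Matrix.of fun i j => sigma1 P f (p i) (p j)) ∧
      AsympNormalVec μ (fun n ω i => skewLambda (empQuantile X n ω) (p i))
        (fun i => skewLambda (quantile P) (p i)) (Matrix.of fun i j => sigma2 P f (p i) (p j))) ∧
    -- asymptotic variances of `g_p` and `l_p` at a single level
    (∀ p ∈ Set.Ioo (0 : ℝ) (1 / 2),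
      RegularAt P f (1 / 2) → RegularAt P f p → RegularAt P f (1 - p) →
      0 < rangeR1 (quantile P) p ∧ 0 < rangeR2 (quantile P) p ∧
      AsympNormal μ (fun n ω => skewGamma (empQuantile X n ω) p) (skewGamma (quantile P) p)
        (sigma1 P f p p) ∧
      AsympNormal μ (fun n ω => skewLambda (empQuantile X n ω) p) (skewLambda (quantile P) p)
        (sigma2 P f p p) ∧
      (skewS (quantile P) p ≠ 0 →
        sigma1 P f p p = skewGamma (quantile P) p ^ 2 *
          (covSS P f p p / skewS (quantile P) p ^ 2 + covR1R1 P f p p / rangeR1 (quantile P) p ^ 2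
            - 2 * covSR1 P f p p / (skewS (quantile P) p * rangeR1 (quantile P) p)) ∧
        sigma2 P f p p = skewLambda (quantile P) p ^ 2 *
          (covSS P f p p / skewS (quantile P) p ^ 2 + covR2R2 P f p p / rangeR2 (quantile P) p ^ 2
            - 2 * covSR2 P f p p / (skewS (quantile P) p * rangeR2 (quantile P) p)))) ∧
    -- the Riemann-sum estimators of the areas under the curves, without and with weight `p`
    (∀ J : ℕ, 0 < J → RegularAt P f (1 / 2) →
      (∀ j ∈ Finset.Icc 1 J,
        RegularAt P f (gridPoint J j) ∧ RegularAt P f (1 - gridPoint J j)) →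
      AsympNormal μ (fun n ω => aucSum J (skewGamma (empQuantile X n ω)))
        (aucSum J (skewGamma (quantile P)))
        (1 / (J : ℝ) ^ 2 * ∑ j ∈ Finset.Icc 1 J, ∑ k ∈ Finset.Icc 1 J,
          sigma1 P f (gridPoint J j) (gridPoint J k)) ∧
      AsympNormal μ (fun n ω => aucSum J (skewLambda (empQuantile X n ω)))
        (aucSum J (skewLambda (quantile P)))
        (1 / (J : ℝ) ^ 2 * ∑ j ∈ Finset.Icc 1 J, ∑ k ∈ Finset.Icc 1 J,
          sigma2 P f (gridPoint J j) (gridPoint J k)) ∧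
      AsympNormal μ (fun n ω => aucSum J (fun p => p * skewGamma (empQuantile X n ω) p))
        (aucSum J (fun p => p * skewGamma (quantile P) p))
        (1 / (J : ℝ) ^ 2 * ∑ j ∈ Finset.Icc 1 J, ∑ k ∈ Finset.Icc 1 J,
          gridPoint J j * gridPoint J k * sigma1 P f (gridPoint J j) (gridPoint J k)) ∧
      AsympNormal μ (fun n ω => aucSum J (fun p => p * skewLambda (empQuantile X n ω) p))
        (aucSum J (fun p => p * skewLambda (quantile P) p))
        (1 / (J : ℝ) ^ 2 * ∑ j ∈ Finset.Icc 1 J, ∑ k ∈ Finset.Icc 1 J,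
          gridPoint J j * gridPoint J k * sigma2 P f (gridPoint J j) (gridPoint J k))) := by
  refine ⟨fun m u hu hreg => ?_, fun m p hp h12 hlo hup => ?_, fun p hp h12 hlo hup => ?_,
    fun J hJ h12 hreg => ?_⟩
  · exact AsympLinear.asympNormalVec hlaw hindep
      (fun i => (hreg i).asympLinear_empQuantile hlaw hindep (hu i))
      (fun i j => integral_quantileInfluence_mul (hu i) (hu j) (hreg i) (hreg j))
  · have ht : ∀ i, RegularTriple P f (p i) := fun i => ⟨hp i, h12, hlo i, hup i⟩
    refine ⟨?_, ?_, ?_, ?_⟩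
    · exact AsympLinear.asympNormalVec_sumElim hlaw hindep
        (fun i => (ht i).asympLinear_skewS hlaw hindep)
        (fun i => (ht i).asympLinear_rangeR1 hlaw hindep)
        (fun i j => integral_influence_skewS_mul_skewS (ht i) (ht j))
        (fun i j => integral_influence_skewS_mul_rangeR1 (ht i) (ht j))
        (fun i j => integral_influence_rangeR1_mul_skewS (ht i) (ht j))
        (fun i j => integral_influence_rangeR1_mul_rangeR1 (ht i) (ht j))
    · exact AsympLinear.asympNormalVec_sumElim hlaw hindep
        (fun i => (ht i).asympLinear_skewS hlaw hindep)
        (fun i => (ht i).asympLinear_rangeR2 hlaw hindep)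
        (fun i j => integral_influence_skewS_mul_skewS (ht i) (ht j))
        (fun i j => integral_influence_skewS_mul_rangeR2 (ht i) (ht j))
        (fun i j => integral_influence_rangeR2_mul_skewS (ht i) (ht j))
        (fun i j => integral_influence_rangeR2_mul_rangeR2 (ht i) (ht j))
    · exact AsympLinear.asympNormalVec hlaw hindep
        (fun i => (ht i).asympLinear_skewGamma hlaw hindep)
        (fun i j => integral_influence_skewGamma_mul hlaw hindep (ht i) (ht j))
    · exact AsympLinear.asympNormalVec hlaw hindep
        (fun i => (ht i).asympLinear_skewLambda hlaw hindep)
        (fun i j => integral_influence_skewLambda_mul hlaw hindep (ht i) (ht j))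
  · have ht : RegularTriple P f p := ⟨hp, h12, hlo, hup⟩
    exact ⟨ht.rangeR1_pos, ht.rangeR2_pos,
      (ht.asympLinear_skewGamma hlaw hindep).asympNormal hlaw hindep
        (integral_influence_skewGamma_mul hlaw hindep ht ht),
      (ht.asympLinear_skewLambda hlaw hindep).asympNormal hlaw hindep
        (integral_influence_skewLambda_mul hlaw hindep ht ht),
      fun hS => ⟨sigma1_self hS ht.rangeR1_pos.ne', sigma2_self hS ht.rangeR2_pos.ne'⟩⟩
  · have ht : ∀ j ∈ Finset.Icc 1 J, RegularTriple P f (gridPoint J j) := fun j hj =>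
      ⟨gridPoint_mem_Ioo hj, h12, (hreg j hj).1, (hreg j hj).2⟩
    have hG := fun w : ℝ → ℝ => asympNormal_aucSum hlaw hindep (J := J) (σ := sigma1 P f)
      (T := fun p n ω => skewGamma (empQuantile X n ω) p) (θ := skewGamma (quantile P))
      (ψ := fun p => quotientInfluence P f (skewS · p) (rangeR1 · p)) w
      (fun j hj => (ht j hj).asympLinear_skewGamma hlaw hindep)
      (fun j hj k hk => integral_influence_skewGamma_mul hlaw hindep (ht j hj) (ht k hk))
    have hL := fun w : ℝ → ℝ => asympNormal_aucSum hlaw hindep (J := J) (σ := sigma2 P f)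
      (T := fun p n ω => skewLambda (empQuantile X n ω) p) (θ := skewLambda (quantile P))
      (ψ := fun p => quotientInfluence P f (skewS · p) (rangeR2 · p)) w
      (fun j hj => (ht j hj).asympLinear_skewLambda hlaw hindep)
      (fun j hj k hk => integral_influence_skewLambda_mul hlaw hindep (ht j hj) (ht k hk))
    exact ⟨by simpa only [one_mul] using hG fun _ => 1, by simpa only [one_mul] using hL fun _ => 1,
      hG fun p => p, hL fun p => p⟩
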